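/- A simple $3$-polytope is a bounded intersection $P\subset\mathbb R^3$ of finitely many closed half-spaces that has non-empty interior and in which every vertex lies on exactly three facets. A linear objective function $\varphi:\mathbb R^3\to\mathbb R$, to be minimized over $P$, is called generic if it takes pairwise distinct values at the vertices of $P$. At a non-optimal vertex $v$ of $P$, the random edge rule moves to a vertex chosen uniformly at random among the improving neighbors of $v$, i.e. the vertices $w$ that are joined to $v$ by an edge of $P$ and satisfy $\varphi(w)<\varphi(v)$. Let $E_{P,\varphi}(v)$ denote the expected number of steps that the random edge rule takes from the vertex $v$ until it reaches the optimal vertex. Let $\lambda(n)$ be the supremum of $E_{P,\varphi}(v)$ over all simple $3$-polytopes $P$ with exactly $n$ facets, all generic linear objective functions $\varphi$, and all vertices $v$ of $P$, and let $$\Lambda(\mathrm{RE})=\limsup_{n\to\infty}\frac{\lambda(n)}{n}$$ be the linearity coefficient of the random edge rule. Theorem. There is an absolute constant $C$ such that for every simple $3$-polytope $P$ with $n$ facets, every generic linear objective function $\varphi$, and every vertex $v$ of $P$, $$E_{P,\varphi}(v)\ \le\ \tfrac{130}{87}\,(n-3)+C .$$ Consequently, $$\Lambda(\mathrm{RE})\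 \le\ \tfrac{130}{87}\ <\ 1.4943 .$$ -/

import Mathlib

open scoped ENNReal

namespace RandomEdge

/-- Three-dimensional Euclidean space. -/
abbrev E3 : Type := EuclideanSpace ℝ (Fin 3)

/-- A polytope: a bounded intersection of finitely many closed half-spaces, that is, the bounded
feasible set of a finite system of linear inequalities. -/
def IsPolytope (P : Set E3) : Prop :=
  Bornology.IsBounded P ∧
    ∃ (m : ℕ) (a : Fin m → E3) (b : Fin m → ℝ), P = {x | ∀ i, inner ℝ (a i) x ≤ b i}

/-- A facet of a 3-dimensional polytope: a face of dimension two. Faces are the sets of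
maximizers over `P` of a linear function (`IsExposed`). -/
def IsFacet (P F : Set E3) : Prop :=
  IsExposed ℝ P F ∧ Module.finrank ℝ (vectorSpan ℝ F) = 2

/-- The number of facets (a polytope has only finitely many). -/
noncomputable def numFacets (P : Set E3) : ℕ :=
  {F : Set E3 | IsFacet P F}.ncard

/-- A simple 3-polytope: a 3-dimensional polytope in which every vertex
lies on exactly three facets. The vertices are the extreme points. -/
def IsSimpleThreePolytope (P : Set E3) : Prop :=
  IsPolytope P ∧ (interior P).Nonempty ∧
    ∀ v ∈ P.extremePoints ℝ, {F : Set E3 | IsFacet P F ∧ v ∈ F}.ncard = 3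

/-- The objective function takes different values at different vertices. -/
def IsGeneric (P : Set E3) (φ : E3 →L[ℝ] ℝ) : Prop :=
  Set.InjOn φ (P.extremePoints ℝ)

/-- Two points are adjacent vertices of `P` if they are the two end points of an edge of `P`. -/
def IsAdjacent (P : Set E3) (v w : E3) : Prop :=
  v ≠ w ∧ IsExposed ℝ P (segment ℝ v w)

/-- The improving neighbors of `v`: the adjacent vertices with smaller objective value
(the objective is minimized). -/
def improvingNeighbors (P : Set E3) (φ : E3 →L[ℝ] ℝ) (v : E3) : Set E3 :=
  {w | IsAdjacent P v w ∧ φ w < φ v}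

open Classical in
/-- One step of the random edge rule: move to an improving neighbor chosen uniformly at random;
stay if there is none. (In a polytope the set of improving neighbors is always finite.) -/
noncomputable def step (P : Set E3) (φ : E3 →L[ℝ] ℝ) (v : E3) : PMF E3 :=
  if h : (improvingNeighbors P φ v).Finite ∧ (improvingNeighbors P φ v).Nonempty then
    PMF.uniformOfFinset h.1.toFinset (h.1.toFinset_nonempty.mpr h.2)
  else PMF.pure v

/-- The distribution of the current vertex `X k` after `k` steps of the random edge rule
started at `v`. -/
noncomputable def walk (P : Set E3) (φ : E3 →L[ℝ] ℝ) : ℕ → E3 → PMF E3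
  | 0, v => PMF.pure v
  | k + 1, v => (step P φ v).bind (walk P φ k)

/-- The expected number of steps that the random edge rule takes from `v` until it reaches an
optimal vertex. Step `k + 1` is taken exactly if `X k` is not optimal, so this is
`∑ k, ℙ (X k is not a minimizer of φ on P)`. -/
noncomputable def expectedSteps (P : Set E3) (φ : E3 →L[ℝ] ℝ) (v : E3) : ℝ≥0∞ :=
  ∑' k : ℕ, (walk P φ k v).toOuterMeasure {x | ¬ IsMinOn φ P x}

/-- The worst-case expected number of steps of the random edge rule, over all linear programs on
simple 3-polytopes with `n` facets with generic objective, and over all starting vertices. -/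
noncomputable def worstCase (n : ℕ) : ℝ≥0∞ :=
  ⨆ (P : Set E3) (φ : E3 →L[ℝ] ℝ) (v : E3) (_ : IsSimpleThreePolytope P) (_ : numFacets P = n)
    (_ : IsGeneric P φ) (_ : v ∈ P.extremePoints ℝ), expectedSteps P φ v

/-- The linearity coefficient of the random edge rule. -/
noncomputable def linearityCoefficient : ℝ≥0∞ :=
  Filter.limsup (fun n : ℕ => worstCase n / (n : ℝ≥0∞)) Filter.atTop

end RandomEdge

/-! Apart from the two extremes, every vertex has one or two improving neighbors (a 1-vertex or a
2-vertex). A 1-vertex is the lowest vertex of the facet avoiding its improving neighbor, and a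
2-vertex is the highest vertex of the facet avoiding its third neighbor. The three facets at the
global minimum (or maximum) are not used in this way, so there are at most n - 3 vertices of each
kind.

Give a 1-vertex the weight 51/50 and all others 237/500, and let U(x) be 64 plus the total weight of
the vertices not above x. Since 51/50 + 237/500 = 747/500 < 130/87, it is enough to show E ≤ U below
the maximum. This goes by induction along φ. Unfold E(v) a few steps as an average over lower
vertices, bound those by U, and compare with the weight passed on the way: distinct vertices are
strictly ordered, so each one skipped adds to the drop of U (`le_of_far`). What makes the local
inequalities true is that a 2-vertex has at most one in-neighbor and a 1-vertex at most two, so a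
vertex reached twice is a 1-vertex and carries the larger weight. Two small subgraphs would violate
the inequalities; each is attached to the rest of the graph by two edges only, which is impossible
in a simple 3-polytope (`false_of_cut`).

The unfolding breaks down only near the minimum. There the walk ends within four steps with
probability at least 1/16, and the constant 64 absorbs this case (`le_of_not_far`).

The geometric part derives the combinatorial axioms `IsSimpleComplex` from an irredundant system of
inequalities: at a vertex exactly three are tight, the edge directions form a negative dual basis of
their normals, and P lies in the cone they span. -/

namespace RandomEdge

/-! ### Digraphs with out-degrees one and two -/

section Digraph

variable {V : Type*} {D : V → V → Prop}

/-- `y` is the only out-neighbor of `x`. -/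
def OutOne (D : V → V → Prop) (x y : V) : Prop := ∀ z, D x z ↔ z = y

/-- `y ≠ z` are the only two out-neighbors of `x`. -/
def OutTwo (D : V → V → Prop) (x y z : V) : Prop := y ≠ z ∧ ∀ u, D x u ↔ u = y ∨ u = z

/-- The vertex has one or two out-neighbors. -/
def OutDeg (D : V → V → Prop) (x : V) : Prop :=
  (∃ y, OutOne D x y) ∨ ∃ y z, OutTwo D x y z

/-- All vertices that can be reached in at most `k` steps have one or two out-neighbors. -/
def Far (D : V → V → Prop) : ℕ → V → Prop
  | 0, x => OutDeg D x
  | k + 1, x => OutDeg D x ∧ ∀ y, D x y → Far D k y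

theorem OutTwo.left {x y z : V} (h : OutTwo D x y z) : D x y := (h.2 y).2 (.inl rfl)

theorem OutTwo.right {x y z : V} (h : OutTwo D x y z) : D x z := (h.2 z).2 (.inr rfl)

theorem OutTwo.symm {x y z : V} (h : OutTwo D x y z) : OutTwo D x z y :=
  ⟨h.1.symm, fun u => (h.2 u).trans or_comm⟩

theorem OutOne.out {x y : V} (h : OutOne D x y) : D x y := (h y).2 rfl

theorem Far.outDeg {k : ℕ} {x : V} (h : Far D k x) : OutDeg D x := by
  cases k with
  | zero => exact h
  | succ k => exact h.1

theorem Far.out {k : ℕ} {x y : V} (h : Far D (k + 1) x) (hy : D x y) : Far D k y := h.2 y hy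

end Digraph

/-! ### Local inequalities for the potential -/

section Descent

variable {V : Type*} [LinearOrder V]

/-- An acyclic digraph with a function `E` that averages over out-neighbors and a strictly
increasing potential `U`, with the degree bounds and the absence of small 2-edge cuts that hold
for the graph of a simple 3-polytope. -/
structure IsDescent (D : V → V → Prop) (E U : V → ℝ) : Prop where
  lt : ∀ {x y}, D x y → y < x
  one : ∀ {x y}, OutOne D x y → E x = 1 + E y
  two : ∀ {x y z}, OutTwo D x y z → E x = 1 + (E y + E z) / 2
  pot : ∀ {x y}, y < x → U y + 237 / 500 ≤ U x
  pot_one : ∀ {x y z}, OutOne D x z → y < x → U y + 51 / 50 ≤ U x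
  in_one : ∀ {x y p q r}, OutOne D x y → D p x → D q x → D r x → p = q ∨ p = r ∨ q = r
  in_two : ∀ {x y z p q}, OutTwo D x y z → D p x → D q x → p = q
  cut_four : ∀ {v x y w}, OutTwo D v x y → OutTwo D x y w → ¬ OutOne D y w
  cut_six : ∀ {v x y z w r}, OutTwo D v x y → OutTwo D x y w → OutOne D y z → OutTwo D z w r →
    ¬ OutOne D w r

namespace IsDescent

variable {D : V → V → Prop} {E U : V → ℝ}

theorem cmp (H : IsDescent D E U) (x y : V) :
    x = y ∨ (y < x ∧ U y + 237 / 500 ≤ U x) ∨ (x < y ∧ U x + 237 / 500 ≤ U y) := by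
  rcases lt_trichotomy x y with h | h | h
  · exact .inr (.inr ⟨h, H.pot h⟩)
  · exact .inl h
  · exact .inr (.inl ⟨h, H.pot h⟩)

theorem cmp_one (H : IsDescent D E U) (x : V) {y z : V} (hy : OutOne D y z) :
    x = y ∨ (y < x ∧ U y + 237 / 500 ≤ U x) ∨ (x < y ∧ U x + 51 / 50 ≤ U y) := by
  rcases lt_trichotomy x y with h | h | h
  · exact .inr (.inr ⟨h, H.pot_one hy h⟩)
  · exact .inl h
  · exact .inr (.inl ⟨h, H.pot h⟩)

/-- The source of the larger weight: a vertex at which two paths merge cannot be a 2-vertex. -/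
theorem exists_outOne (H : IsDescent D E U) {x p q : V} (hx : OutDeg D x) (hp : D p x)
    (hq : D q x) (h : p ≠ q) : ∃ y, OutOne D x y := by
  rcases hx with hx | ⟨y, z, hx⟩
  · exact hx
  · exact absurd (H.in_two hx hp hq) h

theorem false_of_in_three (H : IsDescent D E U) {x p q r : V} (hx : OutDeg D x) (hp : D p x)
    (hq : D q x) (hr : D r x) (hpq : p ≠ q) (hpr : p ≠ r) (hqr : q ≠ r) : False := by
  obtain ⟨y, hy⟩ := H.exists_outOne hx hp hq hpq
  rcases H.in_one hy hp hq hr with h | h | h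
  exacts [hpq h, hpr h, hqr h]

theorem outDeg_cases (H : IsDescent D E U) {x : V} (hx : OutDeg D x) :
    (∃ y, OutOne D x y ∧ y < x ∧ E x = 1 + E y) ∨
      ∃ y z, OutTwo D x y z ∧ z < y ∧ y < x ∧ E x = 1 + (E y + E z) / 2 := by
  rcases hx with ⟨y, hy⟩ | ⟨y, z, hyz⟩
  · exact .inl ⟨y, hy, H.lt hy.out, H.one hy⟩
  · rcases lt_or_gt_of_ne hyz.1 with h | h
    · exact .inr ⟨z, y, hyz.symm, h, H.lt hyz.right, H.two hyz.symm⟩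
    · exact .inr ⟨y, z, hyz, h, H.lt hyz.left, H.two hyz⟩

/-- The higher out-neighbor is a 1-vertex. -/
theorem le_of_outOne_left (H : IsDescent D E U) {v x y c : V}
    (hE : ∀ t < v, E t ≤ U t) (hv : OutTwo D v x y) (hyx : y < x)
    (hx : OutOne D x c) (hy : OutDeg D y) : E v ≤ U v := by
  have hxv := H.lt hv.left
  have hcx := H.lt hx.out
  have e1 := H.two hv
  have e2 := H.one hx
  have p1 := H.pot hxv
  have p2 := H.pot_one hx hyx
  have p3 := H.pot_one hx hcx
  rcases H.cmp c y with rfl | ⟨h, k⟩ | ⟨h, k⟩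
  -- The common vertex has in-neighbors x and v, so it is a 1-vertex. Here E v = 5/2 + E z, while U
  -- drops by at least 237/500 + 2 · 51/50 = 2.514.
  · obtain ⟨z, hz⟩ := H.exists_outOne hy hx.out hv.right hxv.ne
    have hzc := H.lt hz.out
    have := H.one hz
    have := H.pot_one hz hzc
    have := hE z (by order)
    linarith
  all_goals
    have := hE c (by order)
    have := hE y (by order)
    linarith

/-- Both out-neighbors are 2-vertices with the same out-neighbors. -/
theorem le_of_square (H : IsDescent D E U) {v x y z w : V}
    (hE : ∀ t < v, E t ≤ U t) (hv : OutTwo D v x y) (hyx : y < x)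
    (hx : OutTwo D x z w) (hy : OutTwo D y z w) (hwz : w < z) (hz : OutDeg D z)
    (hw : OutDeg D w) : E v ≤ U v := by
  have hxv := H.lt hv.left
  have hzy := H.lt hy.left
  have e1 := H.two hx
  have e2 := H.two hy
  have e3 := H.two hv
  have p1 := H.pot hxv
  have p2 := H.pot hyx
  have p3 := H.pot hzy
  obtain ⟨c, hc⟩ := H.exists_outOne hz hx.left hy.left hyx.ne'
  have hcz := H.lt hc.out
  have e4 := H.one hc
  have := hE c (by order)
  have := hE w (by order)
  have p4 := H.pot_one hc hcz
  have p5 := H.pot_one hc hwz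
  rcases H.cmp c w with rfl | ⟨h, k⟩ | ⟨h, k⟩
  · exact (H.false_of_in_three hw hx.right hy.right hc.out hyx.ne' (by order) (by order)).elim
  all_goals linarith

/-- Both out-neighbors are 2-vertices with exactly one common out-neighbor. -/
theorem le_of_common (H : IsDescent D E U) {v x y z w t : V}
    (hE : ∀ t < v, E t ≤ U t) (hv : OutTwo D v x y) (hyx : y < x)
    (hx : OutTwo D x w z) (hy : OutTwo D y z t) (hwt : w ≠ t) (hz : OutDeg D z)
    (hw : OutDeg D w) : E v ≤ U v := by
  have hxv := H.lt hv.left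
  have hzy := H.lt hy.left
  have hty := H.lt hy.right
  have hwx := H.lt hx.left
  have e1 := H.two hx
  have e2 := H.two hy
  have e3 := H.two hv
  have p1 := H.pot hxv
  have p2 := H.pot hyx
  have p3 := H.pot hzy
  have p4 := H.pot hty
  have p5 := H.pot hwx
  have := hE z (by order)
  have := hE t (by order)
  have := hE w (by order)
  have := hE y (by order)
  obtain ⟨u, hu⟩ := H.exists_outOne hz hx.right hy.left hyx.ne'
  rcases H.cmp w y with rfl | ⟨h1, k1⟩ | ⟨h1, k1⟩
  · exact absurd (H.in_two hy hx.left hv.right) hxv.ne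
  · rcases H.cmp_one t hu with rfl | ⟨h2, k2⟩ | ⟨h2, k2⟩
    · exact absurd rfl hy.1
    · linarith
    -- With w above y and t below z, the direct bounds fall short, so w is unfolded as well. Its
    -- out-neighbors avoid y and z, which have no room for another in-neighbor.
    · rcases H.outDeg_cases hw with ⟨c, hc, hcw, e4⟩ | ⟨c, d, hcd, hdc, hcw, e4⟩
      · have := hE c (by order)
        have := H.pot_one hc hcw
        have := H.pot_one hc h1
        linarith
      · have := hE c (by order)
        have := hE d (by order)
        have := H.pot hcw
        have := H.pot hdc
        rcases H.cmp c y with rfl | ⟨h3, k3⟩ | ⟨h3, k3⟩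
        · exact absurd (H.in_two hy hcd.left hv.right) (by order)
        · linarith
        · rcases H.cmp_one c hu with rfl | ⟨h4, k4⟩ | ⟨h4, k4⟩
          · exact (H.false_of_in_three hz hx.right hy.left hcd.left
              hyx.ne' (by order) (by order)).elim
          · linarith
          · linarith
  · rcases H.cmp_one w hu with rfl | ⟨h2, k2⟩ | ⟨h2, k2⟩
    · exact absurd rfl hx.1
    all_goals
      rcases H.cmp_one t hu with rfl | ⟨h3, k3⟩ | ⟨h3, k3⟩
      · exact absurd rfl hy.1
      all_goals
        rcases H.cmp w t with rfl | ⟨h4, k4⟩ | ⟨h4, k4⟩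
        · exact absurd rfl hwt
        all_goals linarith

/-- Both out-neighbors are 2-vertices with no common out-neighbor. -/
theorem le_of_four (H : IsDescent D E U) {v x y z w s t : V}
    (hE : ∀ t < v, E t ≤ U t) (hv : OutTwo D v x y) (hyx : y < x)
    (hx : OutTwo D x s t) (hts : t < s) (hy : OutTwo D y z w) (hwz : w < z)
    (hsz : s ≠ z) (hsw : s ≠ w) (htz : t ≠ z) (htw : t ≠ w) : E v ≤ U v := by
  have hxv := H.lt hv.left
  have hzy := H.lt hy.left
  have hsx := H.lt hx.left
  have e1 := H.two hx
  have e2 := H.two hy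
  have e3 := H.two hv
  have p1 := H.pot hxv
  have p2 := H.pot hyx
  have p3 := H.pot hzy
  have p4 := H.pot hsx
  have p5 := H.pot hts
  have p6 := H.pot hwz
  have := hE z (by order)
  have := hE t (by order)
  have := hE w (by order)
  have := hE s (by order)
  -- Stopping at y suffices when s and t both lie above y. Otherwise y is unfolded to z and w.
  have := hE y (by order)
  rcases H.cmp s y with rfl | ⟨h1, k1⟩ | ⟨h1, k1⟩
  · exact absurd (H.in_two hy hx.left hv.right) hxv.ne
  all_goals
    rcases H.cmp t y with rfl | ⟨h2, k2⟩ | ⟨h2, k2⟩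
    · exact absurd (H.in_two hy hx.right hv.right) hxv.ne
    all_goals
      rcases H.cmp s z with rfl | ⟨h3, k3⟩ | ⟨h3, k3⟩
      · exact absurd rfl hsz
      all_goals
        rcases H.cmp t z with rfl | ⟨h4, k4⟩ | ⟨h4, k4⟩
        · exact absurd rfl htz
        all_goals
          rcases H.cmp s w with rfl | ⟨h5, k5⟩ | ⟨h5, k5⟩
          · exact absurd rfl hsw
          all_goals
            rcases H.cmp t w with rfl | ⟨h6, k6⟩ | ⟨h6, k6⟩
            · exact absurd rfl htw
            all_goals linarith

/-- The lower out-neighbor is a 1-vertex and not an out-neighbor of the higher one. -/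
theorem le_of_outOne_right (H : IsDescent D E U) {v x y z s t : V}
    (hE : ∀ t < v, E t ≤ U t) (hv : OutTwo D v x y) (hyx : y < x)
    (hx : OutTwo D x s t) (hts : t < s) (hy : OutOne D y z)
    (hys : s ≠ y) (hyt : t ≠ y) : E v ≤ U v := by
  have hxv := H.lt hv.left
  have hzy := H.lt hy.out
  have hsx := H.lt hx.left
  have e1 := H.two hx
  have e2 := H.one hy
  have e3 := H.two hv
  have p1 := H.pot hxv
  have p2 := H.pot hyx
  have p3 := H.pot_one hy hzy
  have p4 := H.pot hsx
  have p5 := H.pot hts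
  have := hE z (by order)
  have := hE t (by order)
  have := hE s (by order)
  have := hE y (by order)
  rcases H.cmp_one s hy with rfl | ⟨h1, k1⟩ | ⟨h1, k1⟩
  · exact absurd rfl hys
  all_goals
    rcases H.cmp_one t hy with rfl | ⟨h2, k2⟩ | ⟨h2, k2⟩
    · exact absurd rfl hyt
    all_goals linarith

end IsDescent
end Descent
-- Triangle configurations
section Triangle

variable {V : Type*} [LinearOrder V] {D : V → V → Prop} {E U : V → ℝ}

namespace IsDescent

/-- A triangle `v, x, y`; the out-neighbor `w` of `x` is above `y`. -/
theorem le_of_triangle_high (H : IsDescent D E U) {v x y w z : V}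
    (hE : ∀ t < v, E t ≤ U t) (hv : OutTwo D v x y) (hx : OutTwo D x y w) (hy : OutOne D y z)
    (hyx : y < x) (hyw : y < w) (hyd : OutDeg D y) (hw : OutDeg D w) : E v ≤ U v := by
  have hxv := H.lt hv.left
  have hzy := H.lt hy.out
  have hwx := H.lt hx.right
  have e1 := H.two hx
  have e2 := H.one hy
  have e3 := H.two hv
  have p1 := H.pot hxv
  have p2 := H.pot hwx
  have p3 := H.pot_one hy hzy
  have p4 := H.pot hyw
  have := hE z (by order)
  rcases H.outDeg_cases hw with ⟨c, hc, hcw, e4⟩ | ⟨c, d, hcd, hdc, hcw, e4⟩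
  · have := hE c (by order)
    have := H.pot_one hc hcw
    have := H.pot_one hc hyw
    linarith
  · have := hE c (by order)
    have := hE d (by order)
    have := H.pot hcw
    have := H.pot hdc
    rcases H.cmp_one c hy with rfl | ⟨h3, k3⟩ | ⟨h3, k3⟩
    · exact (H.false_of_in_three hyd hv.right hx.left hcd.left
        (by order) (by order) (by order)).elim
    all_goals linarith

/-- A triangle `v, x, y` whose three vertices have `z` and `w < z` as further out-neighbors;
`z` is a 1-vertex. -/
theorem le_of_triangle_one (H : IsDescent D E U) {v x y w z c : V}
    (hE : ∀ t < v, E t ≤ U t) (hv : OutTwo D v x y) (hx : OutTwo D x y w) (hy : OutOne D y z)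
    (hyx : y < x) (hwz : w < z) (hz : OutOne D z c) (hw : OutDeg D w) : E v ≤ U v := by
  have hxv := H.lt hv.left
  have hzy := H.lt hy.out
  have hcz := H.lt hz.out
  have e1 := H.two hx
  have e2 := H.one hy
  have e3 := H.two hv
  have e4 := H.one hz
  have p1 := H.pot hxv
  have p2 := H.pot hyx
  have p3 := H.pot_one hy hzy
  have p4 := H.pot_one hz hwz
  have p5 := H.pot_one hz hcz
  have := hE c (by order)
  have := hE w (by order)
  rcases H.cmp c w with rfl | ⟨h1, k1⟩ | ⟨h1, k1⟩
  · obtain ⟨r, hr⟩ := H.exists_outOne hw hx.right hz.out (by order)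
    have hrc := H.lt hr.out
    have := H.pot_one hr hrc
    have := H.one hr
    have := hE r (by order)
    linarith
  all_goals linarith

/-- A triangle `v, x, y` followed by a triangle-like configuration `z, w, r`. -/
theorem le_of_triangle_meet (H : IsDescent D E U) {v x y w z r : V}
    (hE : ∀ t < v, E t ≤ U t) (hv : OutTwo D v x y) (hx : OutTwo D x y w) (hy : OutOne D y z)
    (hyx : y < x) (hwz : w < z) (hz : OutTwo D z w r) (hw : OutDeg D w) (hr : OutDeg D r) :
    E v ≤ U v := by
  have hxv := H.lt hv.left
  have hzy := H.lt hy.out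
  have hrz := H.lt hz.right
  have e1 := H.two hx
  have e2 := H.one hy
  have e3 := H.two hv
  have e4 := H.two hz
  have p1 := H.pot hxv
  have p2 := H.pot hyx
  have p3 := H.pot_one hy hzy
  have p4 := H.pot hwz
  have p5 := H.pot hrz
  have := hE w (by order)
  have := hE r (by order)
  -- The paths through x and through z merge at w, so w is a 1-vertex. The coincidence q = r is the
  -- six-vertex cut.
  obtain ⟨q, hq⟩ := H.exists_outOne hw hx.right hz.left (by order)
  have hqw := H.lt hq.out
  have e5 := H.one hq
  have := hE q (by order)
  have := H.pot_one hq hqw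
  rcases H.cmp_one r hq with rfl | ⟨h1, k1⟩ | ⟨h1, k1⟩
  · exact absurd rfl hz.1
  · rcases H.outDeg_cases hr with ⟨c, hc, hcr, e6⟩ | ⟨c, d, hcd, hdc, hcr, e6⟩
    · have := hE c (by order)
      have := H.pot_one hc hcr
      have := H.pot_one hc h1
      linarith
    · have := hE c (by order)
      have := hE d (by order)
      have := H.pot hcr
      have := H.pot hdc
      have hnc : ∀ u, D r u → u ≠ w := by
        rintro u hu rfl
        exact H.false_of_in_three hw hx.right hz.left hu (by order) (by order) (by order)
      rcases H.cmp_one c hq with rfl | ⟨h2, k2⟩ | ⟨h2, k2⟩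
      · exact absurd rfl (hnc _ hcd.left)
      all_goals
        rcases H.cmp_one d hq with rfl | ⟨h3, k3⟩ | ⟨h3, k3⟩
        · exact absurd rfl (hnc _ hcd.right)
        all_goals linarith
  · rcases H.cmp q r with rfl | ⟨h2, k2⟩ | ⟨h2, k2⟩
    · exact (H.cut_six hv hx hy hz hq).elim
    all_goals linarith

/-- A triangle `v, x, y` whose exits `z`, `w` have no edge in common, and `z` is a 2-vertex. -/
theorem le_of_triangle_two (H : IsDescent D E U) {v x y w z c d : V}
    (hE : ∀ t < v, E t ≤ U t) (hv : OutTwo D v x y) (hx : OutTwo D x y w) (hy : OutOne D y z)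
    (hyx : y < x) (hwz : w < z) (hz : OutTwo D z c d) (hdc : d < c) (hcw : c ≠ w) (hdw : d ≠ w)
    (hw : OutDeg D w) (hc : OutDeg D c) (hd : OutDeg D d) : E v ≤ U v := by
  have hxv := H.lt hv.left
  have hzy := H.lt hy.out
  have hcz := H.lt hz.left
  have e1 := H.two hx
  have e2 := H.one hy
  have e3 := H.two hv
  have e4 := H.two hz
  have p1 := H.pot hxv
  have p2 := H.pot hyx
  have p3 := H.pot_one hy hzy
  have p4 := H.pot hwz
  have p5 := H.pot hcz
  have p6 := H.pot hdc
  have := hE w (by order)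
  have := hE z (by order)
  have := hE c (by order)
  have := hE d (by order)
  -- If c and d both lie above w, the direct bounds suffice. In the other two orders the highest of
  -- c, d, w is unfolded once more.
  rcases H.cmp c w with rfl | ⟨h1, k1⟩ | ⟨h1, k1⟩
  · exact absurd rfl hcw
  · rcases H.cmp d w with rfl | ⟨h2, k2⟩ | ⟨h2, k2⟩
    · exact absurd rfl hdw
    · linarith
    · rcases H.outDeg_cases hc with ⟨q, hq, hqc, e6⟩ | ⟨p, q, hpq, hqp, hpc, e6⟩
      · have := hE q (by order)
        have := H.pot_one hq hqc
        have := H.pot_one hq h1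
        linarith
      · have := hE p (by order)
        have := hE q (by order)
        have := H.pot hpc
        have := H.pot hqp
        rcases H.cmp p w with rfl | ⟨h3, k3⟩ | ⟨h3, k3⟩
        · obtain ⟨r, hr⟩ := H.exists_outOne hw hx.right hpq.left (by order)
          have := H.pot_one hr h2
          linarith
        · linarith
        · rcases H.cmp p d with rfl | ⟨h4, k4⟩ | ⟨h4, k4⟩
          · obtain ⟨r, hr⟩ := H.exists_outOne hd hz.right hpq.left (by order)
            have := H.pot_one hr hqp
            linarith
          all_goals linarith
  · have := hE c (by order)
    rcases H.outDeg_cases hw with ⟨q, hq, hqw, e6⟩ | ⟨p, q, hpq, hqp, hpw, e6⟩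
    · have := hE q (by order)
      have := H.pot_one hq hqw
      have := H.pot_one hq h1
      linarith
    · have := hE p (by order)
      have := hE q (by order)
      have := H.pot hpw
      have := H.pot hqp
      rcases H.cmp p c with rfl | ⟨h3, k3⟩ | ⟨h3, k3⟩
      · obtain ⟨r, hr⟩ := H.exists_outOne hc hz.left hpq.left (by order)
        have := H.pot_one hr hdc
        linarith
      all_goals linarith

/-- A triangle `v, x, y` in which `y` is a 1-vertex. -/
theorem le_of_triangle (H : IsDescent D E U) {v x y w z : V}
    (hE : ∀ t < v, E t ≤ U t) (hv : OutTwo D v x y) (hx : OutTwo D x y w) (hy : OutOne D y z)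
    (hyx : y < x) (hyd : OutDeg D y) (hw : OutDeg D w) (hz : Far D 1 z) : E v ≤ U v := by
  have hxv := H.lt hv.left
  have hwx := H.lt hx.right
  have hzy := H.lt hy.out
  rcases lt_trichotomy w y with h | rfl | h
  · rcases lt_trichotomy w z with h' | rfl | h'
    · rcases H.outDeg_cases hz.outDeg with ⟨c, hc, -⟩ | ⟨c, d, hcd, hdc, -⟩
      · exact H.le_of_triangle_one hE hv hx hy hyx h' hc hw
      · by_cases hcw : c = w
        · subst hcw
          exact H.le_of_triangle_meet hE hv hx hy hyx h' hcd hw (hz.out hcd.right)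
        · by_cases hdw : d = w
          · subst hdw
            exact H.le_of_triangle_meet hE hv hx hy hyx h' hcd.symm hw (hz.out hcd.left)
          · exact H.le_of_triangle_two hE hv hx hy hyx h' hcd hdc hcw hdw hw
              (hz.out hcd.left) (hz.out hcd.right)
    · exact absurd hy (H.cut_four hv hx)
    · have e1 := H.two hx
      have e2 := H.one hy
      have e3 := H.two hv
      have := H.pot hxv
      have := H.pot hyx
      have := H.pot_one hy h
      have := H.pot h'
      have := hE w (by order)
      have := hE z (by order)
      linarith
  · exact absurd rfl hx.1
  · exact H.le_of_triangle_high hE hv hx hy hyx h hyd hw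

/-- The bound at a vertex from which all vertices reachable in four steps have one or two
out-neighbors. -/
theorem le_of_far (H : IsDescent D E U) {v : V} (hE : ∀ t < v, E t ≤ U t) (hv : Far D 4 v) :
    E v ≤ U v := by
  rcases H.outDeg_cases hv.outDeg with ⟨y, hy, hyv, e⟩ | ⟨x, y, hxy, hyx, hxv, -⟩
  · have := H.pot_one hy hyv
    have := hE y hyv
    linarith
  have fx := hv.out hxy.left
  have fy := hv.out hxy.right
  rcases H.outDeg_cases fx.outDeg with ⟨c, hc, -⟩ | ⟨s, t, hst, hts, -⟩
  · exact H.le_of_outOne_left hE hxy hyx hc fy.outDeg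
  have fs := fx.out hst.left
  have ft := fx.out hst.right
  rcases H.outDeg_cases fy.outDeg with ⟨z, hz, -⟩ | ⟨z, w, hzw, hwz, -⟩
  · by_cases hs : s = y
    · subst hs
      exact H.le_of_triangle hE hxy hst hz hyx fy.outDeg ft.outDeg
        ⟨(fy.out hz.out).outDeg, fun u hu => ((fy.out hz.out).out hu).outDeg⟩
    by_cases ht : t = y
    · subst ht
      exact H.le_of_triangle hE hxy hst.symm hz hyx fy.outDeg fs.outDeg
        ⟨(fy.out hz.out).outDeg, fun u hu => ((fy.out hz.out).out hu).outDeg⟩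
    exact H.le_of_outOne_right hE hxy hyx hst hts hz hs ht
  · by_cases hsz : s = z
    · subst hsz
      by_cases htw : t = w
      · subst htw
        exact H.le_of_square hE hxy hyx hst hzw hts fs.outDeg ft.outDeg
      · exact H.le_of_common hE hxy hyx hst.symm hzw htw fs.outDeg ft.outDeg
    by_cases hsw : s = w
    · subst hsw
      by_cases htz : t = z
      · subst htz
        exact absurd hts hwz.not_gt
      · exact H.le_of_common hE hxy hyx hst.symm hzw.symm htz fs.outDeg ft.outDeg
    by_cases htz : t = z
    · subst htz
      exact H.le_of_common hE hxy hyx hst hzw hsw ft.outDeg fs.outDeg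
    by_cases htw : t = w
    · subst htw
      exact H.le_of_common hE hxy hyx hst hzw.symm hsz ft.outDeg fs.outDeg
    exact H.le_of_four hE hxy hyx hst hts hzw hwz hsz hsw htz htw

end IsDescent
end Triangle

/-! ### Combinatorics of simple 3-polytopes -/

/-- The vertex-facet incidences of a simple 3-polytope whose vertices are linearly ordered by a
generic objective function. -/
structure IsSimpleComplex {V ι : Type*} [LinearOrder V] (Adj : V → V → Prop) (M : ι → Set V) :
    Prop where
  symm : ∀ {x y}, Adj x y → Adj y x
  irrefl : ∀ {x}, ¬ Adj x x
  ncard_adj : ∀ x, {y | Adj x y}.ncard = 3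
  ncard_adj_mem : ∀ {i x}, x ∈ M i → {y | Adj x y ∧ y ∈ M i}.ncard = 2
  exists_notMem : ∀ {x y}, Adj x y → ∃ i, x ∈ M i ∧ y ∉ M i
  common : ∀ {i j p q r}, p ∈ M i → p ∈ M j → q ∈ M i → q ∈ M j → r ∈ M i → r ∈ M j →
    p ≠ q → p ≠ r → q ≠ r → i = j
  min : ∀ {x}, (∀ y, Adj x y → x < y) → ∀ y, x ≤ y
  max : ∀ {x}, (∀ y, Adj x y → y < x) → ∀ y, y ≤ x
  facet_min : ∀ {i x}, x ∈ M i → (∀ y ∈ M i, Adj x y → x < y) → ∀ y ∈ M i, x ≤ y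
  facet_max : ∀ {i x}, x ∈ M i → (∀ y ∈ M i, Adj x y → y < x) → ∀ y ∈ M i, y ≤ x

/-- Downward edges. -/
def Down {V : Type*} [LinearOrder V] (Adj : V → V → Prop) (x y : V) : Prop := Adj x y ∧ y < x

namespace IsSimpleComplex

variable {V ι : Type*} [LinearOrder V] {Adj : V → V → Prop} {M : ι → Set V}

theorem exists_three (H : IsSimpleComplex Adj M) (x : V) :
    ∃ a b c, a ≠ b ∧ a ≠ c ∧ b ≠ c ∧ ∀ y, Adj x y ↔ y = a ∨ y = b ∨ y = c := by
  obtain ⟨a, b, c, hab, hac, hbc, h⟩ := Set.ncard_eq_three.1 (H.ncard_adj x)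
  exact ⟨a, b, c, hab, hac, hbc, fun y => by simpa using Set.ext_iff.1 h y⟩

theorem eq_of_adj (H : IsSimpleComplex Adj M) {x a b c y : V} (ha : Adj x a) (hb : Adj x b)
    (hc : Adj x c) (hab : a ≠ b) (hac : a ≠ c) (hbc : b ≠ c) (hy : Adj x y) :
    y = a ∨ y = b ∨ y = c := by
  obtain ⟨a', b', c', -, -, -, h⟩ := H.exists_three x
  rw [h] at ha hb hc hy
  grind

theorem exists_third (H : IsSimpleComplex Adj M) {x a b : V} (ha : Adj x a) (hb : Adj x b)
    (hab : a ≠ b) : ∃ c, Adj x c ∧ c ≠ a ∧ c ≠ b ∧ ∀ y, Adj x y → y = a ∨ y = b ∨ y = c := by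
  obtain ⟨a', b', c', h1, h2, h3, h⟩ := H.exists_three x
  simp only [h] at ha hb ⊢
  rcases ha with rfl | rfl | rfl <;> rcases hb with rfl | rfl | rfl
  · exact absurd rfl hab
  · exact ⟨c', by grind⟩
  · exact ⟨b', by grind⟩
  · exact ⟨c', by grind⟩
  · exact absurd rfl hab
  · exact ⟨a', by grind⟩
  · exact ⟨b', by grind⟩
  · exact ⟨a', by grind⟩
  · exact absurd rfl hab

/-- Two of the three neighbors of x lie in the facet, so at most one misses it. -/
theorem mem_of_notMem (H : IsSimpleComplex Adj M) {i : ι} {x y z : V} (hx : x ∈ M i)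
    (hy : Adj x y) (hyi : y ∉ M i) (hz : Adj x z) (hzy : z ≠ y) : z ∈ M i := by
  obtain ⟨a, b, c, h1, h2, h3, h⟩ := H.exists_three x
  obtain ⟨p, q, hpq, h'⟩ := Set.ncard_eq_two.1 (H.ncard_adj_mem hx)
  have hp := (Set.ext_iff.1 h' p).2 (by simp)
  have hq := (Set.ext_iff.1 h' q).2 (by simp)
  have hp' := hp.1
  have hq' := hq.1
  have := hp.2
  have := hq.2
  rw [h] at hy hz hp' hq'
  grind

theorem exists_mem_adj (H : IsSimpleComplex Adj M) {i : ι} {x : V} (hx : x ∈ M i) :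
    ∃ a b, a ≠ b ∧ ∀ y, Adj x y ∧ y ∈ M i ↔ y = a ∨ y = b := by
  obtain ⟨p, q, hpq, h⟩ := Set.ncard_eq_two.1 (H.ncard_adj_mem hx)
  exact ⟨p, q, hpq, fun y => by simpa using Set.ext_iff.1 h y⟩

/-- An edge lies in two facets. -/
theorem exists_two_facets (H : IsSimpleComplex Adj M) {x y : V} (h : Adj x y) :
    ∃ i j, i ≠ j ∧ x ∈ M i ∧ y ∈ M i ∧ x ∈ M j ∧ y ∈ M j := by
  obtain ⟨a, b, c, hab, hac, hbc, hx⟩ := H.exists_three x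
  have key : ∃ p q, Adj x p ∧ Adj x q ∧ p ≠ q ∧ y ≠ p ∧ y ≠ q := by
    simp only [hx] at h ⊢
    rcases h with rfl | rfl | rfl
    · exact ⟨b, c, by grind⟩
    · exact ⟨a, c, by grind⟩
    · exact ⟨a, b, by grind⟩
  obtain ⟨p, q, hp, hq, hpq, hyp, hyq⟩ := key
  obtain ⟨i, hi, hi'⟩ := H.exists_notMem hp
  obtain ⟨j, hj, hj'⟩ := H.exists_notMem hq
  refine ⟨i, j, ?_, hi, H.mem_of_notMem hi hp hi' h hyp, hj, H.mem_of_notMem hj hq hj' h hyq⟩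
  rintro rfl
  exact hi' (H.mem_of_notMem hj hq hj' hp hpq)

open Classical in
/-- A facet that enters a set of vertices with two exits by one of them contains the other. -/
theorem mem_of_cut [Finite V] (H : IsSimpleComplex Adj M) {S : Set V} {p q p' : V}
    (hp : p ∈ S) (hpp' : Adj p p') (hp' : p' ∉ S)
    (hpS : ∀ y, Adj p y → y ∈ S ∨ y = p') (hS : ∀ x ∈ S, x ≠ p → x ≠ q → ∀ y, Adj x y → y ∈ S)
    {i : ι} (hpi : p ∈ M i) (hpi' : p' ∈ M i) : q ∈ M i := by
  by_contra hq
  have := Fintype.ofFinite V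
  -- Handshake argument: in the part of the facet's graph inside S, every degree would be 2 except
  -- that of p, which loses the edge to p' and has degree 1. A single odd vertex is impossible.
  let G : SimpleGraph ↥(S ∩ M i) :=
    { Adj := fun x y => Adj x y
      symm := ⟨fun _ _ h => H.symm h⟩
      loopless := ⟨fun _ h => H.irrefl h⟩ }
  have hdeg (x : ↥(S ∩ M i)) : G.degree x = {y | Adj x y ∧ y ∈ M i ∧ y ∈ S}.ncard := by
    rw [← G.card_neighborFinset_eq_degree, ← Set.ncard_coe_finset,
      ← Set.ncard_image_of_injective _ Subtype.val_injective]
    congr 1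
    ext y
    simp [G]
    tauto
  have hodd : ({x | Odd (G.degree x)} : Finset _) = {⟨p, hp, hpi⟩} := by
    ext x
    simp only [Finset.mem_filter, Finset.mem_univ, true_and, Finset.mem_singleton]
    obtain ⟨a, b, hab, h⟩ := H.exists_mem_adj x.2.2
    rw [hdeg]
    constructor
    · intro ho
      by_contra hne
      have h1 : {y | Adj x y ∧ y ∈ M i ∧ y ∈ S} = {y | Adj x y ∧ y ∈ M i} := by
        ext y
        refine ⟨fun h => ⟨h.1, h.2.1⟩, fun h => ⟨h.1, h.2, hS x x.2.1 ?_ ?_ y h.1⟩⟩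
        · exact fun e => hne (Subtype.ext e)
        · rintro rfl
          exact hq x.2.2
      rw [h1, H.ncard_adj_mem x.2.2] at ho
      revert ho
      decide
    · rintro rfl
      have h1 : {y | Adj p y ∧ y ∈ M i ∧ y ∈ S} = {y | Adj p y ∧ y ∈ M i} \ {p'} := by
        ext y
        simp only [Set.mem_ofPred_eq, Set.mem_sdiff, Set.mem_singleton_iff]
        constructor
        · exact fun h => ⟨⟨h.1, h.2.1⟩, fun e => hp' (e ▸ h.2.2)⟩
        · exact fun h => ⟨h.1.1, h.1.2, (hpS y h.1.1).resolve_right h.2⟩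
      rw [h1, Set.ncard_sdiff_singleton_of_mem (show p' ∈ {y | Adj p y ∧ y ∈ M i} from ⟨hpp', hpi'⟩), H.ncard_adj_mem hpi]
      decide
  have := G.even_card_odd_degree_vertices
  rw [hodd, Finset.card_singleton] at this
  exact absurd this (by decide)

/-- There is no set of vertices with exactly two exits. -/
theorem false_of_cut [Finite V] (H : IsSimpleComplex Adj M) {S : Set V} {p q p' : V}
    (hp : p ∈ S) (hq : q ∈ S) (hpq : p ≠ q) (hpp' : Adj p p') (hp' : p' ∉ S)
    (hpS : ∀ y, Adj p y → y ∈ S ∨ y = p')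
    (hS : ∀ x ∈ S, x ≠ p → x ≠ q → ∀ y, Adj x y → y ∈ S) : False := by
  -- Both facets at the exit edge p p' must also contain q, so two distinct facets would share three
  -- vertices.
  obtain ⟨i, j, hij, h1, h2, h3, h4⟩ := H.exists_two_facets hpp'
  refine hij (H.common h1 h3 (H.mem_of_cut hp hpp' hp' hpS hS h1 h2)
    (H.mem_of_cut hp hpp' hp' hpS hS h3 h4) h2 h4 hpq ?_ ?_)
  · rintro rfl
    exact hp' hp
  · rintro rfl
    exact hp' hq

theorem in_one (H : IsSimpleComplex Adj M) {x y p q r : V} (hx : OutOne (Down Adj) x y)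
    (hp : Down Adj p x) (hq : Down Adj q x) (hr : Down Adj r x) : p = q ∨ p = r ∨ q = r := by
  by_contra! h
  have hy := hx.out
  rcases H.eq_of_adj (H.symm hp.1) (H.symm hq.1) (H.symm hr.1) h.1 h.2.1 h.2.2 hy.1 with
    rfl | rfl | rfl
  · exact lt_asymm hy.2 hp.2
  · exact lt_asymm hy.2 hq.2
  · exact lt_asymm hy.2 hr.2

theorem in_two (H : IsSimpleComplex Adj M) {x y z p q : V} (hx : OutTwo (Down Adj) x y z)
    (hp : Down Adj p x) (hq : Down Adj q x) : p = q := by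
  by_contra! h
  have hy := hx.left
  have hz := hx.right
  rcases H.eq_of_adj (H.symm hp.1) hy.1 hz.1 (hy.2.trans hp.2).ne' (hz.2.trans hp.2).ne' hx.1
    (H.symm hq.1) with rfl | rfl | rfl
  · exact h rfl
  · exact lt_asymm hy.2 hq.2
  · exact lt_asymm hz.2 hq.2

/-- The four vertices would span K₄ minus the edge vw, with exits only at v and w. -/
theorem not_cut_four [Finite V] (H : IsSimpleComplex Adj M) {v x y w : V}
    (hv : OutTwo (Down Adj) v x y) (hx : OutTwo (Down Adj) x y w) : ¬ OutOne (Down Adj) y w := by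
  intro hy
  have hxv := hv.left
  have hyv := hv.right
  have hyx := hx.left
  have hwx := hx.right
  have hwy := hy.out
  obtain ⟨p, hp, hpx, hpy, h⟩ := H.exists_third hxv.1 hyv.1 hv.1
  have hvp : v < p := by
    by_contra hc
    rcases eq_or_lt_of_le (not_lt.1 hc) with rfl | h'
    · exact H.irrefl hp
    · exact ((hv.2 p).1 ⟨hp, h'⟩).elim hpx hpy
  have o1 := hxv.2
  have o2 := hyx.2
  have o3 := hwy.2
  refine H.false_of_cut (S := {v, x, y, w}) (p := v) (q := w) (p' := p) (by simp) (by simp)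
    (by order) hp ?_ ?_ ?_
  · simp only [Set.mem_insert_iff, Set.mem_singleton_iff, not_or]
    refine ⟨?_, ?_, ?_, ?_⟩ <;> order
  · intro u hu
    rcases h u hu with rfl | rfl | rfl <;> simp
  · rintro u (rfl | rfl | rfl | rfl) h1 h2 t ht
    · exact absurd rfl h1
    · rcases H.eq_of_adj (H.symm hxv.1) hyx.1 hwx.1 (by order) (by order) hx.1 ht with
        rfl | rfl | rfl <;> simp
    · rcases H.eq_of_adj (H.symm hyv.1) (H.symm hyx.1) hwy.1 (by order) (by order) (by order) ht
        with rfl | rfl | rfl <;> simp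
    · exact absurd rfl h2

/-- The six vertices would span a triangular prism minus the edge vr: triangles v, x, y and r, w, z,
joined by xw and yz. The only exits are at v and r. -/
theorem not_cut_six [Finite V] (H : IsSimpleComplex Adj M) {v x y z w r : V}
    (hv : OutTwo (Down Adj) v x y) (hx : OutTwo (Down Adj) x y w) (hy : OutOne (Down Adj) y z)
    (hz : OutTwo (Down Adj) z w r) : ¬ OutOne (Down Adj) w r := by
  intro hw
  have hxv := hv.left
  have hyv := hv.right
  have hyx := hx.left
  have hwx := hx.right
  have hzy := hy.out
  have hwz := hz.left
  have hrz := hz.right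
  have hrw := hw.out
  obtain ⟨p, hp, hpx, hpy, h⟩ := H.exists_third hxv.1 hyv.1 hv.1
  have hvp : v < p := by
    by_contra hc
    rcases eq_or_lt_of_le (not_lt.1 hc) with rfl | h'
    · exact H.irrefl hp
    · exact ((hv.2 p).1 ⟨hp, h'⟩).elim hpx hpy
  have o1 := hxv.2
  have o2 := hyx.2
  have o3 := hzy.2
  have o4 := hwz.2
  have o5 := hrw.2
  refine H.false_of_cut (S := {v, x, y, z, w, r}) (p := v) (q := r) (p' := p) (by simp) (by simp)
    (by order) hp ?_ ?_ ?_
  · simp only [Set.mem_insert_iff, Set.mem_singleton_iff, not_or]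
    refine ⟨?_, ?_, ?_, ?_, ?_, ?_⟩ <;> order
  · intro u hu
    rcases h u hu with rfl | rfl | rfl <;> simp
  · rintro u (rfl | rfl | rfl | rfl | rfl | rfl) h1 h2 t ht
    · exact absurd rfl h1
    · rcases H.eq_of_adj (H.symm hxv.1) hyx.1 hwx.1 (by order) (by order) hx.1 ht with
        rfl | rfl | rfl <;> simp
    · rcases H.eq_of_adj (H.symm hyv.1) (H.symm hyx.1) hzy.1 (by order) (by order) (by order) ht
        with rfl | rfl | rfl <;> simp
    · rcases H.eq_of_adj (H.symm hzy.1) hwz.1 hrz.1 (by order) (by order) (by order) ht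
        with rfl | rfl | rfl <;> simp
    · rcases H.eq_of_adj (H.symm hwx.1) (H.symm hwz.1) hrw.1 (by order) (by order) (by order) ht
        with rfl | rfl | rfl <;> simp
    · exact absurd rfl h2

/-- A vertex that is neither the minimum nor the maximum has one or two improving neighbors. -/
theorem outDeg (H : IsSimpleComplex Adj M) {x s t : V} (hs : s < x) (ht : x < t) :
    OutDeg (Down Adj) x := by
  obtain ⟨a, b, c, hab, hac, hbc, h⟩ := H.exists_three x
  have h1 : ∃ y, Adj x y ∧ y < x := by
    by_contra! hc
    exact (H.min (fun y hy => lt_of_le_of_ne (hc y hy) fun e => H.irrefl (e ▸ hy)) s).not_gt hs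
  have h2 : ∃ y, Adj x y ∧ x < y := by
    by_contra! hc
    exact (H.max (fun y hy => lt_of_le_of_ne (hc y hy) fun e => H.irrefl (e ▸ hy)) t).not_gt ht
  have hne : ∀ y, Adj x y → y ≠ x := fun y hy e => H.irrefl (e ▸ hy)
  unfold OutDeg OutOne OutTwo Down
  simp only [h] at h1 h2 hne ⊢
  have ha := hne a (by simp)
  have hb := hne b (by simp)
  have hc := hne c (by simp)
  rcases lt_or_gt_of_ne ha with ha | ha <;> rcases lt_or_gt_of_ne hb with hb | hb <;>
    rcases lt_or_gt_of_ne hc with hc | hc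
  · grind
  · exact .inr ⟨a, b, hab, by grind⟩
  · exact .inr ⟨a, c, hac, by grind⟩
  · exact .inl ⟨a, by grind⟩
  · exact .inr ⟨b, c, hbc, by grind⟩
  · exact .inl ⟨b, by grind⟩
  · exact .inl ⟨c, by grind⟩
  · grind

/-- Vertices that are extremal on a facet, together with a vertex extremal on all its facets. -/
theorem ncard_add_three_le [Finite V] [Finite ι] (H : IsSimpleComplex Adj M) {R : V → V → Prop}
    (hR : ∀ x y, R x y → R y x → x = y) {A : Set V} {s : V} (hs : s ∉ A)
    (hA : ∀ x ∈ A, ∃ i, x ∈ M i ∧ ∀ y ∈ M i, R x y) (hsR : ∀ y, R s y) :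
    A.ncard + 3 ≤ Nat.card ι := by
  obtain ⟨a, b, c, hab, hac, hbc, h⟩ := H.exists_three s
  have ha : Adj s a := by simp [h]
  have hb : Adj s b := by simp [h]
  have hc : Adj s c := by simp [h]
  obtain ⟨i, hi, hi'⟩ := H.exists_notMem ha
  have : Nonempty ι := ⟨i⟩
  choose! f hf using hA
  obtain ⟨j, hj, hj'⟩ := H.exists_notMem hb
  obtain ⟨k, hk, hk'⟩ := H.exists_notMem hc
  have hij : i ≠ j := by
    rintro rfl
    exact hj' (H.mem_of_notMem hi ha hi' hb hab.symm)
  have hik : i ≠ k := by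
    rintro rfl
    exact hk' (H.mem_of_notMem hi ha hi' hc hac.symm)
  have hjk : j ≠ k := by
    rintro rfl
    exact hk' (H.mem_of_notMem hj hb hj' hc hbc.symm)
  -- A facet has at most one extremal vertex, so the chosen facets are distinct. They also differ
  -- from the three facets at s, whose extremal vertex is s itself.
  have hinj : Set.InjOn f A := by
    intro x hx y hy hxy
    exact hR _ _ ((hf x hx).2 y (hxy ▸ (hf y hy).1)) ((hf y hy).2 x (hxy ▸ (hf x hx).1))
  have hdis : Disjoint (f '' A) {i, j, k} := by
    rw [Set.disjoint_left]
    rintro _ ⟨x, hx, rfl⟩ hm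
    have hsx : s ∈ M (f x) := by
      rcases hm with h | h | h <;> rw [h] <;> assumption
    exact hs (hR _ _ ((hf x hx).2 s hsx) (hsR x) ▸ hx)
  have h3 : ({i, j, k} : Set ι).ncard = 3 := Set.ncard_eq_three.2 ⟨i, j, k, hij, hik, hjk, rfl⟩
  calc A.ncard + 3 = (f '' A ∪ {i, j, k}).ncard := by
        rw [Set.ncard_union_eq hdis, hinj.ncard_image, h3]
    _ ≤ (Set.univ : Set ι).ncard := Set.ncard_le_ncard (Set.subset_univ _)
    _ = Nat.card ι := Set.ncard_univ _

/-- In the facet through x that avoids its only improving neighbor, both neighbors of x are higher,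
so x is the lowest vertex there. -/
theorem ncard_outOne_add_three_le [Finite V] [Finite ι] (H : IsSimpleComplex Adj M) {s : V}
    (hs : ∀ y, s ≤ y) : {x | ∃ y, OutOne (Down Adj) x y}.ncard + 3 ≤ Nat.card ι := by
  refine H.ncard_add_three_le (R := (· ≤ ·)) (fun x y => le_antisymm) (s := s) ?_ ?_ hs
  · rintro ⟨y, hy⟩
    exact (hs y).not_gt hy.out.2
  · rintro x ⟨y, hy⟩
    obtain ⟨i, hi, hi'⟩ := H.exists_notMem hy.out.1
    refine ⟨i, hi, H.facet_min hi fun z hz hxz => lt_of_not_ge fun h => ?_⟩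
    rcases eq_or_lt_of_le h with rfl | h
    · exact H.irrefl hxz
    · exact hi' ((hy z).1 ⟨hxz, h⟩ ▸ hz)

/-- In the facet that avoids the third neighbor of x, both neighbors of x are the improving ones, so
x is the highest vertex there. -/
theorem ncard_outTwo_add_three_le [Finite V] [Finite ι] (H : IsSimpleComplex Adj M) {t : V}
    (ht : ∀ y, y ≤ t) : {x | x ≠ t ∧ ∃ y z, OutTwo (Down Adj) x y z}.ncard + 3 ≤ Nat.card ι := by
  refine H.ncard_add_three_le (R := (· ≥ ·)) (fun x y h h' => le_antisymm h' h) (s := t) ?_ ?_ ht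
  · rintro ⟨h, -⟩
    exact h rfl
  · rintro x ⟨hxt, y, z, hyz⟩
    obtain ⟨p, hp, hpy, hpz, h⟩ := H.exists_third hyz.left.1 hyz.right.1 hyz.1
    obtain ⟨i, hi, hi'⟩ := H.exists_notMem hp
    refine ⟨i, hi, H.facet_max hi fun u hu hxu => ?_⟩
    rcases h u hxu with rfl | rfl | rfl
    · exact hyz.left.2
    · exact hyz.right.2
    · exact absurd hu hi'

end IsSimpleComplex

/-! ### The potential and the global induction -/

/-- A vertex close to a vertex without cost. -/
theorem IsDescent.le_of_not_far {V : Type*} [LinearOrder V] {D : V → V → Prop} {E U : V → ℝ}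
    (H : IsDescent D E U) {v : V} {m : ℝ} (hm : 0 ≤ m) (hE : ∀ t < v, E t ≤ m)
    (hD : ∀ x ≤ v, ¬ OutDeg D x → E x = 0) :
    ∀ (k : ℕ) {x : V}, x ≤ v → ¬ Far D k x → E x ≤ (1 - (1 / 2) ^ k) * m + k := by
  -- Some path of at most k steps leads to a vertex with E = 0, and each of its steps has
  -- probability at least 1/2. A branch that leaves the path is bounded by m.
  intro k
  induction k with
  | zero =>
    intro x hx h
    rw [hD x hx h]
    simp
  | succ k ih =>
    intro x hx h
    have hp : (0 : ℝ) < (1 / 2) ^ k := by positivity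
    have hp1 : ((1 : ℝ) / 2) ^ k ≤ 1 := pow_le_one₀ (by norm_num) (by norm_num)
    have hpm := mul_nonneg hp.le hm
    have hpm' := mul_nonneg (sub_nonneg.2 hp1) hm
    have hk : (0 : ℝ) ≤ k := k.cast_nonneg
    by_cases hd : OutDeg D x
    · obtain ⟨y, hxy, hy⟩ : ∃ y, D x y ∧ ¬ Far D k y := by
        by_contra! hc
        exact h ⟨hd, hc⟩
      have hyx := H.lt hxy
      have hEy := ih (hyx.le.trans hx) hy
      push_cast
      rw [pow_succ]
      rcases hd with ⟨z, hz⟩ | ⟨z, w, hzw⟩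
      · obtain rfl := (hz y).1 hxy
        rw [H.one hz]
        linarith
      · have hz := hE z ((H.lt hzw.left).trans_le hx)
        have hw := hE w ((H.lt hzw.right).trans_le hx)
        rw [H.two hzw]
        rcases (hzw.2 y).1 hxy with rfl | rfl <;> linarith
    · rw [hD x hx hd]
      push_cast
      rw [pow_succ]
      linarith

namespace IsSimpleComplex

variable {V ι : Type*} [LinearOrder V] {Adj : V → V → Prop} {M : ι → Set V}

open Classical in
/-- The weight of a vertex, depending on its number of improving neighbors. -/
noncomputable def weight (Adj : V → V → Prop) (x : V) : ℝ :=
  if ∃ y, OutOne (Down Adj) x y then 51 / 50 else 237 / 500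

theorem le_weight (x : V) : 237 / 500 ≤ weight Adj x := by
  unfold weight
  split_ifs <;> norm_num

theorem weight_of_outOne {x y : V} (h : OutOne (Down Adj) x y) : weight Adj x = 51 / 50 :=
  if_pos ⟨y, h⟩

open Finset in
/-- A constant plus the total weight of the vertices that are not higher than `x`. -/
noncomputable def potential [Fintype V] (Adj : V → V → Prop) (x : V) : ℝ :=
  64 + ∑ y with y ≤ x, weight Adj y

theorem potential_add_le [Fintype V] {x y : V} (h : y < x) :
    potential Adj y + weight Adj x ≤ potential Adj x := by
  unfold potential
  have h1 : ∑ z with z ≤ y, weight Adj z + weight Adj x =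
      ∑ z ∈ insert x (Finset.univ.filter (· ≤ y)), weight Adj z := by
    rw [Finset.sum_insert (by simpa using h), add_comm]
  rw [add_assoc, h1]
  refine add_le_add_right (Finset.sum_le_sum_of_subset_of_nonneg ?_
    fun z _ _ => le_trans (by norm_num) (le_weight (Adj := Adj) z)) _
  intro z
  simp only [Finset.mem_insert, Finset.mem_filter, Finset.mem_univ, true_and]
  rintro (rfl | hz)
  exacts [le_rfl, hz.trans h.le]

theorem le_potential [Fintype V] (x : V) : 64 ≤ potential Adj x :=
  le_add_of_nonneg_right (Finset.sum_nonneg fun z _ => le_trans (by norm_num) (le_weight z))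

theorem weight_of_not {x : V} (h : ¬ ∃ y, OutOne (Down Adj) x y) : weight Adj x = 237 / 500 :=
  if_neg h

theorem isDescent [Fintype V] (H : IsSimpleComplex Adj M) {E : V → ℝ}
    (hone : ∀ {x y}, OutOne (Down Adj) x y → E x = 1 + E y)
    (htwo : ∀ {x y z}, OutTwo (Down Adj) x y z → E x = 1 + (E y + E z) / 2) :
    IsDescent (Down Adj) E (potential Adj) where
  lt h := h.2
  one := hone
  two := htwo
  pot h := (add_le_add_right (le_weight _) _).trans (potential_add_le h)
  pot_one h h' := by
    rw [← weight_of_outOne h]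
    exact potential_add_le h'
  in_one := H.in_one
  in_two := H.in_two
  cut_four := H.not_cut_four
  cut_six := H.not_cut_six

/-- The total weight is bounded in terms of the number of facets. -/
theorem potential_le [Fintype V] [Finite ι] (H : IsSimpleComplex Adj M) {s t : V}
    (hs : ∀ y, s ≤ y) (ht : ∀ y, y ≤ t) (x : V) :
    potential Adj x ≤ 130 / 87 * (Nat.card ι - 3) + 65 := by
  classical
  set A : Set V := {x | ∃ y, OutOne (Down Adj) x y}
  set B : Set V := {x | x ≠ t ∧ ∃ y z, OutTwo (Down Adj) x y z}
  have hA : (A.ncard : ℝ) + 3 ≤ Nat.card ι := mod_cast H.ncard_outOne_add_three_le hs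
  have hB : (B.ncard : ℝ) + 3 ≤ Nat.card ι := mod_cast H.ncard_outTwo_add_three_le ht
  have h1 : ∀ y, weight Adj y ≤ A.indicator (fun _ => 51 / 50) y +
      B.indicator (fun _ => 237 / 500) y + ({s} : Set V).indicator (fun _ => 237 / 500) y +
      ({t} : Set V).indicator (fun _ => 237 / 500) y := by
    intro y
    have p (S : Set V) : (0 : ℝ) ≤ S.indicator (fun _ => 237 / 500) y :=
      Set.indicator_nonneg (fun _ _ => by norm_num) y
    have pB := p B
    have ps := p {s}
    have pt := p {t}
    by_cases hyA : y ∈ A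
    · obtain ⟨z, hz⟩ := id hyA
      rw [Set.indicator_of_mem hyA, weight_of_outOne hz]
      linarith
    · rw [Set.indicator_of_notMem hyA, weight_of_not hyA]
      have hy : y ∈ B ∨ y ∈ ({s} : Set V) ∨ y ∈ ({t} : Set V) := by
        by_contra! hc
        rcases H.outDeg (lt_of_le_of_ne (hs y) (Ne.symm hc.2.1)) (lt_of_le_of_ne (ht y) hc.2.2) with
          h | h
        · exact hyA h
        · exact hc.1 ⟨hc.2.2, h⟩
      rcases hy with hy | hy | hy <;> rw [Set.indicator_of_mem hy] <;> linarith
  have hcard : ∀ (S : Set V) (r : ℝ), ∑ y, S.indicator (fun _ => r) y = S.ncard * r := by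
    intro S r
    rw [Finset.sum_indicator_eq_sum_filter, Finset.sum_const, nsmul_eq_mul,
      ← Set.ncard_coe_finset]
    simp
  have h2 : ∑ y, weight Adj y ≤ A.ncard * (51 / 50) + B.ncard * (237 / 500) + 237 / 500
      + 237 / 500 := by
    refine (Finset.sum_le_sum fun y _ => h1 y).trans ?_
    rw [Finset.sum_add_distrib, Finset.sum_add_distrib, Finset.sum_add_distrib, hcard, hcard,
      hcard, hcard, Set.ncard_singleton, Set.ncard_singleton, Nat.cast_one, one_mul]
  have h3 : ∑ y with y ≤ x, weight Adj y ≤ ∑ y, weight Adj y :=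
    Finset.sum_le_sum_of_subset_of_nonneg (Finset.subset_univ _)
      fun z _ _ => le_trans (by norm_num) (le_weight z)
  -- This gives n ≥ 3, so that 747/500 may be replaced by 130/87. The two extremes contribute 2 ·
  -- 237/500 < 1, which turns 64 into 65.
  have hA0 : (0 : ℝ) ≤ A.ncard := Nat.cast_nonneg _
  unfold potential
  linarith

/-- The expected number of steps in terms of the number of facets. -/
theorem expected_le [Finite V] [Finite ι] (H : IsSimpleComplex Adj M) {E : V → ℝ}
    (hmin : ∀ x, (∀ y, x ≤ y) → E x = 0)
    (hone : ∀ x y, OutOne (Down Adj) x y → E x = 1 + E y)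
    (htwo : ∀ x y z, OutTwo (Down Adj) x y z → E x = 1 + (E y + E z) / 2)
    (hmax : ∀ x y, Down Adj x y → ∃ z, Down Adj x z ∧ E x ≤ 1 + E z) (v : V) :
    E v ≤ 130 / 87 * (Nat.card ι - 3) + 66 := by
  have := Fintype.ofFinite V
  have : Nonempty V := ⟨v⟩
  obtain ⟨s, hs⟩ := Finite.exists_min (id : V → V)
  obtain ⟨t, ht⟩ := Finite.exists_max (id : V → V)
  have D := H.isDescent (hone _ _) (htwo _ _ _)
  have key : ∀ v, v < t → E v ≤ potential Adj v := by
    intro v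
    induction v using WellFoundedLT.induction with
    | ind v ih =>
      intro hvt
      have hE : ∀ u < v, E u ≤ potential Adj u := fun u hu => ih u hu (hu.trans hvt)
      by_cases hv : Far (Down Adj) 4 v
      · exact D.le_of_far hE hv
      -- With k = 4 and m = U v the bound is 15/16 · m + 4, which is at most m exactly when m ≥ 64.
      · have hv64 := le_potential (Adj := Adj) v
        have := D.le_of_not_far (m := potential Adj v) (by linarith)
          (fun u hu => (hE u hu).trans (by linarith [D.pot hu]))
          (fun x hx h => hmin x fun y => ?_) 4 le_rfl hv
        · norm_num at this
          linarith
        · rcases eq_or_lt_of_le (hs x) with h' | h'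
          · exact h'.symm.trans_le (hs y)
          · exact absurd (H.outDeg h' (hx.trans_lt hvt)) h
  rcases eq_or_lt_of_le (ht v) with h | h
  -- The maximum is outside the local analysis, as all its neighbors can be improving. Its first
  -- step accounts for the passage from 65 to 66.
  · by_cases hv : ∃ y, Down Adj v y
    · obtain ⟨y, hy⟩ := hv
      obtain ⟨z, hz, hvz⟩ := hmax v y hy
      have h1 := key z (hz.2.trans_eq h)
      have h2 := H.potential_le hs ht z
      linarith
    · have hmin' : ∀ y, v ≤ y := H.min fun y hy => by
        refine lt_of_not_ge fun hc => ?_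
        rcases eq_or_lt_of_le hc with rfl | hc
        · exact H.irrefl hy
        · exact hv ⟨y, hy, hc⟩
      rw [hmin v hmin']
      have h2 := H.potential_le hs ht v
      have h3 := le_potential (Adj := Adj) v
      linarith
  · have h1 := key v h
    have h2 := H.potential_le hs ht v
    linarith

end IsSimpleComplex

/-! ### Irredundant systems and the geometry at a vertex -/

open Filter Topology

/-- An irredundant description of a set by linear inequalities: every inequality is the only one
that is tight at some point. -/
structure IsIrredundant {ι : Type*} (P : Set E3) (a : ι → E3) (b : ι → ℝ) : Prop where
  mem_iff : ∀ {x}, x ∈ P ↔ ∀ i, inner ℝ (a i) x ≤ b i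
  ne_zero : ∀ i, a i ≠ 0
  exists_mem : ∀ i, ∃ q ∈ P, inner ℝ (a i) q = b i ∧ ∀ j, j ≠ i → inner ℝ (a j) q < b j

theorem inner_lt_of_mem_interior {P : Set E3} {a : E3} {b : ℝ} (ha : a ≠ 0)
    (h : ∀ x ∈ P, inner ℝ a x ≤ b) {x : E3} (hx : x ∈ interior P) : inner ℝ a x < b := by
  have h1 : ∀ᶠ t : ℝ in 𝓝[>] 0, x + t • a ∈ P := by
    have hc : Tendsto (fun t : ℝ => x + t • a) (𝓝 0) (𝓝 x) := by
      have : Continuous fun t : ℝ => x + t • a := by fun_prop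
      simpa using this.tendsto 0
    exact (hc.eventually (mem_interior_iff_mem_nhds.1 hx)).filter_mono nhdsWithin_le_nhds
  obtain ⟨t, ht, ht0⟩ := (h1.and self_mem_nhdsWithin).exists
  have h2 := h _ ht
  rw [inner_add_right, inner_smul_right] at h2
  have h3 : 0 < inner ℝ a a := real_inner_self_pos.2 ha
  have h4 : 0 < t * inner ℝ a a := mul_pos ht0 h3
  linarith

theorem exists_isIrredundant {P : Set E3} (hP : (interior P).Nonempty) {m : ℕ} {a : Fin m → E3}
    {b : Fin m → ℝ} (h : P = {x | ∀ i, inner ℝ (a i) x ≤ b i}) :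
    ∃ J : Finset (Fin m), IsIrredundant P (fun i : J => a i) (fun i : J => b i) := by
  classical
  let good : Finset (Fin m) → Prop := fun J => P = {x | ∀ i ∈ J, inner ℝ (a i) x ≤ b i}
  have hgood : good Finset.univ := by simpa [good] using h
  -- By minimality, dropping inequality i from J admits a point y violating only i. The segment from
  -- an interior point z to y crosses the hyperplane of i where all other inequalities are strict.
  obtain ⟨J, hJ, hmin⟩ := exists_minimal_of_wellFoundedLT good ⟨_, hgood⟩
  obtain ⟨z, hz⟩ := hP
  have hmem : ∀ x, x ∈ P ↔ ∀ i ∈ J, inner ℝ (a i) x ≤ b i := fun x => by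
    conv_lhs => rw [show P = _ from hJ]
    rfl
  have hex : ∀ i ∈ J, ∃ y, b i < inner ℝ (a i) y ∧ ∀ j ∈ J, j ≠ i → inner ℝ (a j) y ≤ b j := by
    intro i hi
    by_contra! hc
    refine absurd (hmin (y := J.erase i) ?_ (J.erase_subset i) hi) (J.notMem_erase i)
    ext x
    rw [hmem]
    refine ⟨fun hx j hj => hx j (Finset.mem_of_mem_erase hj), fun hx j hj => ?_⟩
    by_contra hlt
    by_cases hji : j = i
    · subst hji
      obtain ⟨k, hk, hkj, hk'⟩ := hc x (not_le.1 hlt)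
      exact hk'.not_ge (hx k (Finset.mem_erase.2 ⟨hkj, hk⟩))
    · exact hlt (hx j (Finset.mem_erase.2 ⟨hji, hj⟩))
  have hzP := (hmem z).1 (interior_subset hz)
  have hne : ∀ i ∈ J, a i ≠ 0 := by
    intro i hi h0
    obtain ⟨y, hy, -⟩ := hex i hi
    have := hzP i hi
    rw [h0, inner_zero_left] at this hy
    linarith
  have hlt : ∀ i ∈ J, inner ℝ (a i) z < b i := fun i hi =>
    inner_lt_of_mem_interior (hne i hi) (fun x hx => (hmem x).1 hx i hi) hz
  refine ⟨J, fun {x} => by simpa using hmem x, fun i => hne i i.2, fun i => ?_⟩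
  obtain ⟨y, hy, hy'⟩ := hex i i.2
  have hi := hlt i i.2
  set t := (b i - inner ℝ (a i) z) / (inner ℝ (a i) y - inner ℝ (a i) z) with ht
  have hpos : 0 < inner ℝ (a i) y - inner ℝ (a i) z := by linarith
  have ht0 : 0 < t := div_pos (by linarith) hpos
  have ht1 : t < 1 := (div_lt_one hpos).2 (by linarith)
  have hin : ∀ j, inner ℝ (a j) (z + t • (y - z)) =
      (1 - t) * inner ℝ (a j) z + t * inner ℝ (a j) y := by
    intro j
    rw [inner_add_right, inner_smul_right, inner_sub_right]
    ring
  have heq : inner ℝ (a i) (z + t • (y - z)) = b i := by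
    have : t * (inner ℝ (a i) y - inner ℝ (a i) z) = b i - inner ℝ (a i) z :=
      div_mul_cancel₀ _ hpos.ne'
    rw [hin]
    linarith
  have hltq : ∀ j : J, j ≠ i → inner ℝ (a j) (z + t • (y - z)) < b j := by
    intro j hj
    rw [hin]
    have h1 := hlt j j.2
    have h2 := hy' j j.2 (fun h => hj (Subtype.ext h))
    have h3 := mul_lt_mul_of_pos_left h1 (sub_pos.2 ht1)
    have h4 := mul_le_mul_of_nonneg_left h2 ht0.le
    linarith
  refine ⟨z + t • (y - z), ?_, heq, hltq⟩
  rw [hmem]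
  intro j hj
  by_cases hji : (⟨j, hj⟩ : J) = i
  · subst hji
    exact heq.le
  · exact (hltq ⟨j, hj⟩ hji).le

namespace IsIrredundant

variable {ι : Type*} {P : Set E3} {a : ι → E3} {b : ι → ℝ}

/-- The face on which an inequality is tight. -/
def tight (P : Set E3) (a : ι → E3) (b : ι → ℝ) (i : ι) : Set E3 := {x ∈ P | inner ℝ (a i) x = b i}

theorem exists_add_smul_mem [Finite ι] (H : IsIrredundant P a b) {x d : E3} (hx : x ∈ P)
    (hd : ∀ i, inner ℝ (a i) x = b i → inner ℝ (a i) d ≤ 0) :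
    ∃ t : ℝ, 0 < t ∧ x + t • d ∈ P := by
  have h : ∀ᶠ t : ℝ in 𝓝[>] 0, ∀ i, inner ℝ (a i) (x + t • d) ≤ b i := by
    rw [eventually_all]
    intro i
    rcases eq_or_lt_of_le (H.mem_iff.1 hx i) with h | h
    · filter_upwards [self_mem_nhdsWithin] with t ht
      rw [inner_add_right, inner_smul_right, h]
      have := mul_nonpos_of_nonneg_of_nonpos (le_of_lt ht) (hd i h)
      linarith
    · have hc : Tendsto (fun t : ℝ => inner ℝ (a i) (x + t • d)) (𝓝 0)
          (𝓝 (inner ℝ (a i) x)) := by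
        have : Continuous fun t : ℝ => inner ℝ (a i) (x + t • d) := by fun_prop
        simpa using this.tendsto 0
      exact ((hc.eventually (gt_mem_nhds h)).mono fun t ht => le_of_lt ht).filter_mono
        nhdsWithin_le_nhds
  obtain ⟨t, ht, ht0⟩ := (h.and self_mem_nhdsWithin).exists
  exact ⟨t, ht0, H.mem_iff.2 ht⟩

theorem convex (H : IsIrredundant P a b) : Convex ℝ P := by
  have : P = ⋂ i, {x | inner ℝ (a i) x ≤ b i} := by
    ext x
    simpa using H.mem_iff
  rw [this]
  exact convex_iInter fun i => convex_halfSpace_le (innerₛₗ ℝ (a i)).isLinear _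

theorem isClosed (H : IsIrredundant P a b) : IsClosed P := by
  have : P = ⋂ i, {x | inner ℝ (a i) x ≤ b i} := by
    ext x
    simpa using H.mem_iff
  rw [this]
  exact isClosed_iInter fun i => isClosed_le (by fun_prop) continuous_const

theorem tight_injective (H : IsIrredundant P a b) : Function.Injective (tight P a b) := by
  intro i j hij
  by_contra hne
  obtain ⟨q, hq, hqi, hqj⟩ := H.exists_mem i
  have : q ∈ tight P a b j := hij ▸ ⟨hq, hqi⟩
  exact (hqj j (Ne.symm hne)).ne this.2

/-- Near the point where only inequality i is tight, every direction orthogonal to `a i` stays in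
the face, so the face spans that whole plane. -/
theorem isFacet_tight [Finite ι] (H : IsIrredundant P a b) (i : ι) :
    IsFacet P (tight P a b i) := by
  obtain ⟨q, hq, hqi, hqj⟩ := H.exists_mem i
  refine ⟨fun _ => ⟨innerSL ℝ (a i), ?_⟩, ?_⟩
  · ext x
    simp only [tight, Set.mem_ofPred_eq, innerSL_apply_apply, and_congr_right_iff]
    refine fun hx => ⟨fun h y hy => h ▸ H.mem_iff.1 hy i, fun h => ?_⟩
    exact le_antisymm (H.mem_iff.1 hx i) (hqi ▸ h q hq)
  · have hspan : vectorSpan ℝ (tight P a b i) = (ℝ ∙ a i)ᗮ := by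
      apply le_antisymm
      · rw [vectorSpan_def, Submodule.span_le]
        rintro _ ⟨x, hx, y, hy, rfl⟩
        rw [SetLike.mem_coe, Submodule.mem_orthogonal_singleton_iff_inner_right]
        change inner ℝ (a i) (x - y) = 0
        rw [inner_sub_right, hx.2, hy.2, sub_self]
      · intro d hd
        rw [Submodule.mem_orthogonal_singleton_iff_inner_right] at hd
        obtain ⟨t, ht, htP⟩ := H.exists_add_smul_mem (d := d) hq fun j hj => by
          by_cases hji : j = i
          · rw [hji, hd]
          · exact absurd hj (hqj j hji).ne
        have h1 : q + t • d ∈ tight P a b i :=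
          ⟨htP, by rw [inner_add_right, inner_smul_right, hd, mul_zero, add_zero, hqi]⟩
        have h2 := vsub_mem_vectorSpan ℝ h1 (show q ∈ tight P a b i from ⟨hq, hqi⟩)
        rw [vsub_eq_sub, add_sub_cancel_left] at h2
        exact (Submodule.smul_mem_iff _ ht.ne').1 h2
    have : Fact (Module.finrank ℝ E3 = 2 + 1) := ⟨by simp⟩
    rw [hspan]
    exact Submodule.finrank_orthogonal_span_singleton (H.ne_zero i)

/-- Otherwise x could be moved a little along both d and -d, and would be interior to a segment in
P. -/
theorem eq_zero_of_tight [Finite ι] (H : IsIrredundant P a b) {x d : E3}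
    (hx : x ∈ P.extremePoints ℝ) (hd : ∀ i, inner ℝ (a i) x = b i → inner ℝ (a i) d = 0) :
    d = 0 := by
  obtain ⟨t, ht, h1⟩ := H.exists_add_smul_mem (d := d) hx.1 fun i hi => (hd i hi).le
  obtain ⟨s, hs, h2⟩ := H.exists_add_smul_mem (d := -d) hx.1 fun i hi => by
    rw [inner_neg_right, hd i hi, neg_zero]
  have h3 : x ∈ openSegment ℝ (x + t • d) (x + s • -d) := by
    refine ⟨s / (s + t), t / (s + t), by positivity, by positivity, by field_simp, ?_⟩
    match_scalars <;> field_simp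
    ring
  have h4 := (mem_extremePoints.1 hx).2 _ h1 _ h2 h3
  simpa [ht.ne'] using h4.1

/-- The index set of the inequalities that are tight at a point. -/
abbrev Tight (a : ι → E3) (b : ι → ℝ) (x : E3) : Type _ := {i // inner ℝ (a i) x = b i}

/-- Distinct tight inequalities give distinct facets, so there are at most three. At an extreme
point the tight normals separate directions, so there are at least three. -/
theorem card_tight [Finite ι] (H : IsIrredundant P a b) {x : E3} (hx : x ∈ P.extremePoints ℝ)
    (h3 : {F : Set E3 | IsFacet P F ∧ x ∈ F}.ncard = 3) :
    Nat.card (Tight a b x) = 3 ∧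
      {F : Set E3 | IsFacet P F ∧ x ∈ F} = Set.range fun i : Tight a b x => tight P a b i := by
  have hinj : Function.Injective fun i : Tight a b x => tight P a b i :=
    H.tight_injective.comp Subtype.val_injective
  have hsub : (Set.range fun i : Tight a b x => tight P a b i) ⊆
      {F : Set E3 | IsFacet P F ∧ x ∈ F} := by
    rintro _ ⟨i, rfl⟩
    exact ⟨H.isFacet_tight i, hx.1, i.2⟩
  have hfin : {F : Set E3 | IsFacet P F ∧ x ∈ F}.Finite := Set.finite_of_ncard_ne_zero (by omega)
  have hcard : (Set.range fun i : Tight a b x => tight P a b i).ncard = Nat.card (Tight a b x) := by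
    rw [← Set.image_univ, Set.ncard_image_of_injective _ hinj, Set.ncard_univ]
  have hle := Set.ncard_le_ncard hsub hfin
  have := Fintype.ofFinite (Tight a b x)
  let L : E3 →ₗ[ℝ] (Tight a b x → ℝ) := LinearMap.pi fun i => innerₛₗ ℝ (a i)
  have hL : Function.Injective L := by
    rw [← LinearMap.ker_eq_bot, LinearMap.ker_eq_bot']
    intro d hd
    exact H.eq_zero_of_tight hx fun i hi => congrFun hd ⟨i, hi⟩
  have hge := LinearMap.finrank_le_finrank_of_injective hL
  rw [finrank_euclideanSpace_fin, Module.finrank_fintype_fun_eq_card,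
    ← Nat.card_eq_fintype_card] at hge
  have h : Nat.card (Tight a b x) = 3 := by omega
  exact ⟨h, (Set.eq_of_subset_of_ncard_le hsub (by omega) hfin).symm⟩

open Classical in
/-- The directions of the edges at a vertex. -/
theorem exists_directions [Finite ι] (H : IsIrredundant P a b) {x : E3}
    (hx : x ∈ P.extremePoints ℝ) (h3 : Nat.card (Tight a b x) = 3) :
    ∃ d : Tight a b x → E3, ∀ i j : Tight a b x,
      inner ℝ (a j) (d i) = if j = i then -1 else 0 := by
  have := Fintype.ofFinite (Tight a b x)
  let L : E3 →ₗ[ℝ] (Tight a b x → ℝ) := LinearMap.pi fun i => innerₛₗ ℝ (a i)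
  have hL : Function.Injective L := by
    rw [← LinearMap.ker_eq_bot, LinearMap.ker_eq_bot']
    intro d hd
    exact H.eq_zero_of_tight hx fun i hi => congrFun hd ⟨i, hi⟩
  have hdim : Module.finrank ℝ E3 = Module.finrank ℝ (Tight a b x → ℝ) := by
    rw [finrank_euclideanSpace_fin, Module.finrank_fintype_fun_eq_card,
      ← Nat.card_eq_fintype_card, h3]
  have hsurj := (LinearMap.injective_iff_surjective_of_finrank_eq_finrank hdim).1 hL
  choose d hd using fun i : Tight a b x => hsurj (Pi.single i (-1))
  refine ⟨d, fun i j => ?_⟩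
  have := congrFun (hd i) j
  rw [Pi.single_apply] at this
  exact this

open Classical in
theorem eq_of_directions [Finite ι] (H : IsIrredundant P a b) {x : E3}
    (hx : x ∈ P.extremePoints ℝ) [Fintype (Tight a b x)] {d : Tight a b x → E3}
    (hd : ∀ i j : Tight a b x, inner ℝ (a j) (d i) = if j = i then -1 else 0) (p : E3) :
    p - x = ∑ i : Tight a b x, (b i - inner ℝ (a i) p) • d i := by
  rw [← sub_eq_zero]
  refine H.eq_zero_of_tight hx fun j hj => ?_
  rw [inner_sub_right, inner_sub_right, inner_sum, hj]
  have : ∀ i : Tight a b x, inner ℝ (a j) ((b i - inner ℝ (a i) p) • d i) =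
      if (⟨j, hj⟩ : Tight a b x) = i then -(b j - inner ℝ (a j) p) else 0 := by
    intro i
    rw [inner_smul_right, hd i ⟨j, hj⟩]
    split_ifs with h
    · subst h
      ring
    · ring
  rw [Finset.sum_congr rfl fun i _ => this i, Finset.sum_ite_eq, if_pos (Finset.mem_univ _)]
  ring

/-- A ray from a point of a bounded polyhedron leaves it at some point. -/
theorem exists_end [Finite ι] (H : IsIrredundant P a b) (hb : Bornology.IsBounded P) {x d : E3}
    (hx : x ∈ P) (hd0 : d ≠ 0) (hd : ∀ i, inner ℝ (a i) x = b i → inner ℝ (a i) d ≤ 0) :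
    ∃ t : ℝ, 0 < t ∧ x + t • d ∈ P ∧ ∀ s, x + s • d ∈ P → s ≤ t := by
  obtain ⟨t₀, ht₀, h₀⟩ := H.exists_add_smul_mem hx hd
  have hcl : IsClosed {s : ℝ | x + s • d ∈ P} := H.isClosed.preimage (by fun_prop)
  have hbd : Bornology.IsBounded {s : ℝ | x + s • d ∈ P} := by
    obtain ⟨R, hR⟩ := hb.exists_norm_le
    refine (isBounded_iff_forall_norm_le).2 ⟨(R + ‖x‖) / ‖d‖, fun s hs => ?_⟩
    rw [le_div_iff₀ (norm_pos_iff.2 hd0), ← norm_smul]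
    have h1 := hR _ hs
    have h2 := norm_sub_le (x + s • d) x
    rw [add_sub_cancel_left] at h2
    linarith
  obtain ⟨t, ht, htm⟩ := (Metric.isCompact_of_isClosed_isBounded hcl hbd).exists_isGreatest ⟨t₀, h₀⟩
  exact ⟨t, ht₀.trans_le (htm h₀), ht, fun s hs => htm hs⟩

open Classical in
/-- The local structure at a simple vertex. -/
theorem exists_star [Finite ι] (H : IsIrredundant P a b) (hb : Bornology.IsBounded P) {x : E3}
    (hx : x ∈ P.extremePoints ℝ) (h3 : Nat.card (Tight a b x) = 3) [Fintype (Tight a b x)] :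
    ∃ y : Tight a b x → E3, (∀ w, IsAdjacent P x w ↔ ∃ i, w = y i) ∧
      (∀ i, y i ∈ P.extremePoints ℝ) ∧
      (∀ i j : Tight a b x, inner ℝ (a j) (y i) = b j ↔ j ≠ i) ∧
      ∀ p ∈ P, ∃ c : Tight a b x → ℝ, (∀ i, 0 ≤ c i) ∧
        (∀ i, c i = 0 ↔ inner ℝ (a i) p = b i) ∧ p - x = ∑ i, c i • (y i - x) := by
  obtain ⟨d, hd⟩ := H.exists_directions hx h3
  have hxP := hx.1
  have hd0 : ∀ i, d i ≠ 0 := by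
    intro i h
    have := hd i i
    rw [h, inner_zero_right, if_pos rfl] at this
    norm_num at this
  have hdle : ∀ i (j : ι), inner ℝ (a j) x = b j → inner ℝ (a j) (d i) ≤ 0 := by
    intro i j hj
    have : inner ℝ (a j) (d i) = _ := hd i ⟨j, hj⟩
    rw [this]
    split_ifs <;> norm_num
  choose t ht0 htP htmax using fun i => H.exists_end hb hxP (hd0 i) (hdle i)
  have hdec := H.eq_of_directions hx hd
  have hy : ∀ i j : Tight a b x, inner ℝ (a j) (x + t i • d i) = b j ↔ j ≠ i := by
    intro i j
    rw [inner_add_right, inner_smul_right, hd i j, j.2]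
    split_ifs with h
    · simp [h, (ht0 i).ne']
    · simp [h]
  -- the edge in direction `d i`
  have hseg : ∀ i, ∀ p ∈ P, (∀ j : Tight a b x, j ≠ i → inner ℝ (a j) p = b j) →
      ∃ s, 0 ≤ s ∧ s ≤ t i ∧ p = x + s • d i := by
    intro i p hp h
    have h1 := hdec p
    rw [Finset.sum_eq_single i (fun j _ hj => by rw [h j hj, sub_self, zero_smul])
      (fun h => absurd (Finset.mem_univ _) h)] at h1
    have h2 : p = x + (b i - inner ℝ (a i) p) • d i := by rw [← h1, add_sub_cancel]
    exact ⟨_, sub_nonneg.2 (H.mem_iff.1 hp i), htmax i _ (h2 ▸ hp), h2⟩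
  have hface : ∀ i, IsExposed ℝ P (segment ℝ x (x + t i • d i)) := by
    intro i _
    -- The sum of the other two tight normals is maximal exactly where both inequalities are tight,
    -- which is the edge in direction `d i`.
    refine ⟨innerSL ℝ (∑ j : Tight a b x with j ≠ i, a j), ?_⟩
    have hval : ∀ p, innerSL ℝ (∑ j : Tight a b x with j ≠ i, a j) p =
        ∑ j : Tight a b x with j ≠ i, inner ℝ (a j) p := by
      intro p
      rw [innerSL_apply_apply, sum_inner]
    ext p
    simp only [Set.mem_ofPred_eq, hval]
    constructor
    · rintro hp
      refine ⟨H.convex.segment_subset hxP (htP i) hp, fun q hq => Finset.sum_le_sum fun j hj => ?_⟩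
      rw [segment_eq_image'] at hp
      obtain ⟨s, -, rfl⟩ := hp
      have hj' := (Finset.mem_filter.1 hj).2
      rw [add_sub_cancel_left, inner_add_right, inner_smul_right, inner_smul_right, hd i j,
        if_neg hj', j.2]
      simpa using H.mem_iff.1 hq j
    · rintro ⟨hp, hmax⟩
      have h1 := hmax x hxP
      have h2 : ∀ j ∈ Finset.univ.filter (fun j : Tight a b x => j ≠ i),
          inner ℝ (a j) p ≤ inner ℝ (a j) x := fun j _ => j.2 ▸ H.mem_iff.1 hp j
      have h4 := (Finset.sum_eq_sum_iff_of_le h2).1 (le_antisymm (Finset.sum_le_sum h2) h1)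
      obtain ⟨s, hs0, hst, rfl⟩ := hseg i p hp fun j hj => by rw [h4 j (by simpa using hj), j.2]
      rw [segment_eq_image']
      refine ⟨s / t i, ⟨div_nonneg hs0 (ht0 i).le, (div_le_one (ht0 i)).2 hst⟩, ?_⟩
      rw [add_sub_cancel_left]
      simp only
      rw [smul_smul, div_mul_cancel₀ _ (ht0 i).ne']
  have hext : ∀ i, x + t i • d i ∈ P.extremePoints ℝ := by
    intro i
    rw [← isExtreme_singleton]
    -- Along the edge `a i` decreases strictly, so its negative exposes the far end.
    refine (hface i).isExtreme.trans (IsExposed.isExtreme (𝕜 := ℝ) fun _ => ⟨innerSL ℝ (-a i), ?_⟩)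
    ext p
    simp only [Set.mem_singleton_iff, Set.mem_ofPred_eq, innerSL_apply_apply, inner_neg_left,
      neg_le_neg_iff]
    constructor
    · rintro rfl
      refine ⟨right_mem_segment _ _ _, fun q hq => ?_⟩
      rw [segment_eq_image'] at hq
      obtain ⟨s, hs, rfl⟩ := hq
      rw [add_sub_cancel_left, inner_add_right, inner_add_right, inner_smul_right,
        inner_smul_right, inner_smul_right, hd i i, if_pos rfl]
      nlinarith [ht0 i, hs.2]
    · rintro ⟨hp, hmax⟩
      rw [segment_eq_image'] at hp
      obtain ⟨s, hs, rfl⟩ := hp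
      have h1 := hmax _ (right_mem_segment _ _ _)
      rw [add_sub_cancel_left, inner_add_right, inner_add_right, inner_smul_right,
        inner_smul_right, hd i i, if_pos rfl] at h1
      have : s = 1 := by
        refine le_antisymm hs.2 ?_
        by_contra hlt
        have := mul_pos (sub_pos.2 (not_le.1 hlt)) (ht0 i)
        linarith
      simp only [this, one_smul, add_sub_cancel_left]
  refine ⟨fun i => x + t i • d i, fun w => ⟨fun hw => ?_, ?_⟩, hext, hy, fun p hp => ?_⟩
  · obtain ⟨hne, hexp⟩ := hw
    obtain ⟨l, hl⟩ := hexp ⟨x, left_mem_segment _ _ _⟩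
    have hwS : w ∈ segment ℝ x w := right_mem_segment _ _ _
    have hxS : x ∈ segment ℝ x w := left_mem_segment _ _ _
    rw [hl] at hwS hxS
    have hlx : ∀ i, l (d i) ≤ 0 := by
      intro i
      have h1 := hxS.2 _ (htP i)
      rw [map_add, map_smul, smul_eq_mul] at h1
      by_contra hlt
      have := mul_pos (ht0 i) (not_le.1 hlt)
      linarith
    have hwd := hdec w
    have hc : ∀ i : Tight a b x, 0 ≤ b i - inner ℝ (a i) w := fun i =>
      sub_nonneg.2 (H.mem_iff.1 hwS.1 i)
    -- The functional l exposing the segment is equal at x and w and does not increase along any `d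
    -- i`. Hence it vanishes on every direction that occurs in w - x, and the corresponding edge
    -- from x lies in the segment.
    have hsum : ∑ i : Tight a b x, (b i - inner ℝ (a i) w) * l (d i) = 0 := by
      have h1 := congrArg l hwd
      rw [map_sub, map_sum, le_antisymm (hxS.2 w hwS.1) (hwS.2 x hxS.1), sub_self] at h1
      simpa using h1.symm
    have hzero := (Finset.sum_eq_zero_iff_of_nonpos
      (fun i _ => mul_nonpos_of_nonneg_of_nonpos (hc i) (hlx i))).1 hsum
    obtain ⟨i, hi⟩ : ∃ i : Tight a b x, b i - inner ℝ (a i) w ≠ 0 := by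
      by_contra! h
      rw [Finset.sum_eq_zero fun i _ => by rw [h i, zero_smul], sub_eq_zero] at hwd
      exact hne hwd.symm
    have hli : l (d i) = 0 := (mul_eq_zero.1 (hzero i (Finset.mem_univ _))).resolve_left hi
    have hyi : x + t i • d i ∈ segment ℝ x w := by
      rw [hl]
      refine ⟨htP i, fun q hq => ?_⟩
      rw [map_add, map_smul, hli, smul_zero, add_zero]
      exact hxS.2 q hq
    -- the extreme point `y i` of the segment `[x, w]` is an end point
    refine ⟨i, ?_⟩
    have h5 := (mem_extremePoints_iff_forall_segment.1 (hext i)).2 x hxP w hwS.1 hyi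
    rcases h5 with h5 | h5
    · refine absurd h5 fun h => ?_
      rw [left_eq_add, smul_eq_zero] at h
      exact h.elim (ht0 i).ne' (hd0 i)
    · exact h5
  · rintro ⟨i, rfl⟩
    refine ⟨fun h => ?_, hface i⟩
    rw [left_eq_add, smul_eq_zero] at h
    exact h.elim (ht0 i).ne' (hd0 i)
  · refine ⟨fun i => (b i - inner ℝ (a i) p) / t i,
      fun i => div_nonneg (sub_nonneg.2 (H.mem_iff.1 hp i)) (ht0 i).le, fun i => ?_, ?_⟩
    · rw [div_eq_zero_iff, or_iff_left (ht0 i).ne', sub_eq_zero, eq_comm]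
    · rw [hdec p]
      refine Finset.sum_congr rfl fun i _ => ?_
      rw [add_sub_cancel_left, smul_smul, div_mul_cancel₀ _ (ht0 i).ne']

end IsIrredundant

/-! ### From polytopes to the combinatorial structure -/

section Polytope

variable {ι : Type*} [Finite ι] {P : Set E3} {a : ι → E3} {b : ι → ℝ}

open Classical in
theorem IsIrredundant.exists_local (H : IsIrredundant P a b) (hb : Bornology.IsBounded P)
    (hs : ∀ v ∈ P.extremePoints ℝ, {F : Set E3 | IsFacet P F ∧ v ∈ F}.ncard = 3) {x : E3}
    (hx : x ∈ P.extremePoints ℝ) [Fintype (IsIrredundant.Tight a b x)] :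
    ∃ y : IsIrredundant.Tight a b x → E3, (∀ w, IsAdjacent P x w ↔ ∃ i, w = y i) ∧
      (∀ i, y i ∈ P.extremePoints ℝ) ∧
      (∀ i j : IsIrredundant.Tight a b x, inner ℝ (a j) (y i) = b j ↔ j ≠ i) ∧
      ∀ p ∈ P, ∃ c : IsIrredundant.Tight a b x → ℝ, (∀ i, 0 ≤ c i) ∧
        (∀ i, c i = 0 ↔ inner ℝ (a i) p = b i) ∧ p - x = ∑ i, c i • (y i - x) :=
  H.exists_star hb hx (H.card_tight hx (hs x hx)).1

theorem IsAdjacent.symm {x y : E3} (h : IsAdjacent P x y) : IsAdjacent P y x :=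
  ⟨h.1.symm, segment_symm ℝ x y ▸ h.2⟩

theorem eq_of_extremePoints_ray {x y q : E3} {c : ℝ} (hx : x ∈ P) (hy : y ∈ P.extremePoints ℝ)
    (hq : q ∈ P.extremePoints ℝ) (hc : 0 ≤ c) (h : q - x = c • (y - x)) (hqx : q ≠ x) :
    q = y := by
  have hq' : q = x + c • (y - x) := by rw [← h, add_sub_cancel]
  rcases le_total c 1 with hc1 | hc1
  · have h1 : q ∈ segment ℝ x y := by
      rw [segment_eq_image']
      exact ⟨c, ⟨hc, hc1⟩, hq'.symm⟩
    rcases (mem_extremePoints_iff_forall_segment.1 hq).2 x hx y hy.1 h1 with h2 | h2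
    · exact absurd h2.symm hqx
    · exact h2.symm
  · have h0 : 0 < c := by linarith
    have h1 : y ∈ segment ℝ x q := by
      rw [segment_eq_image']
      refine ⟨c⁻¹, ⟨inv_nonneg.2 hc, inv_le_one_of_one_le₀ hc1⟩, ?_⟩
      simp only
      rw [h, smul_smul, inv_mul_cancel₀ h0.ne', one_smul, add_sub_cancel]
    rcases (mem_extremePoints_iff_forall_segment.1 hy).2 x hx q hq.1 h1 with h2 | h2
    · rw [← h2, sub_self, smul_zero, sub_eq_zero] at h
      exact absurd h hqx
    · exact h2

/-- The local optimality criterion on a polytope and on its facets. -/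
theorem IsIrredundant.le_of_adj (H : IsIrredundant P a b) (hb : Bornology.IsBounded P)
    (hs : ∀ v ∈ P.extremePoints ℝ, {F : Set E3 | IsFacet P F ∧ v ∈ F}.ncard = 3) {x p : E3}
    (hx : x ∈ P.extremePoints ℝ) (hp : p ∈ P) {S : Set ι}
    (hSx : ∀ i ∈ S, inner ℝ (a i) x = b i) (hSp : ∀ i ∈ S, inner ℝ (a i) p = b i) (φ : E3 →L[ℝ] ℝ)
    (h : ∀ y ∈ P.extremePoints ℝ, IsAdjacent P x y → (∀ i ∈ S, inner ℝ (a i) y = b i) →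
      φ x ≤ φ y) : φ x ≤ φ p := by
  have := Fintype.ofFinite (IsIrredundant.Tight a b x)
  obtain ⟨y, hadj, hext, hy, hcone⟩ := H.exists_local hb hs hx
  obtain ⟨c, hc0, hc, hpx⟩ := hcone p hp
  rw [← sub_nonneg, ← map_sub, hpx, map_sum]
  refine Finset.sum_nonneg fun i _ => ?_
  rw [map_smul, map_sub, smul_eq_mul]
  by_cases hi : (i : ι) ∈ S
  · rw [(hc i).2 (hSp i hi), zero_mul]
  · refine mul_nonneg (hc0 i) (sub_nonneg.2 (h _ (hext i) ((hadj _).2 ⟨i, rfl⟩) fun j hj => ?_))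
    exact (hy i ⟨j, hSx j hj⟩).2 fun e => hi (by rw [← e]; exact hj)

theorem IsIrredundant.isSimpleComplex (H : IsIrredundant P a b) (hb : Bornology.IsBounded P)
    (hs : ∀ v ∈ P.extremePoints ℝ, {F : Set E3 | IsFacet P F ∧ v ∈ F}.ncard = 3)
    (φ : E3 →L[ℝ] ℝ) [LinearOrder (P.extremePoints ℝ)]
    (hφ : ∀ x y : P.extremePoints ℝ, x < y ↔ φ x < φ y) :
    IsSimpleComplex (V := P.extremePoints ℝ) (ι := ι) (fun x y => IsAdjacent P x y)
      fun i => {x | inner ℝ (a i) x = b i} := by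
  classical
  have := fun x : E3 => Fintype.ofFinite (IsIrredundant.Tight a b x)
  have hle : ∀ x y : P.extremePoints ℝ, x ≤ y ↔ φ x ≤ φ y := fun x y => by
    rw [← not_lt, hφ, not_lt]
  have hcard : ∀ x ∈ P.extremePoints ℝ, Nat.card (IsIrredundant.Tight a b x) = 3 :=
    fun x hx => (H.card_tight hx (hs x hx)).1
  refine
    { symm := fun h => h.symm
      irrefl := fun h => h.1 rfl
      ncard_adj := ?_
      ncard_adj_mem := ?_
      exists_notMem := ?_
      common := ?_
      min := fun {x} hx p => ?_
      max := fun {x} hx p => ?_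
      facet_min := fun {i x} hxi hx p hp => ?_
      facet_max := fun {i x} hxi hx p hp => ?_ }
  · rintro ⟨x, hx⟩
    obtain ⟨y, hadj, hext, hy, -⟩ := H.exists_local hb hs hx
    have hinj : Function.Injective fun i => (⟨y i, hext i⟩ : P.extremePoints ℝ) := by
      intro i j hij
      by_contra hne
      have h1 := (hy i j).2 (Ne.symm hne)
      rw [show y i = y j from congrArg Subtype.val hij] at h1
      exact (hy j j).1 h1 rfl
    have : {w : P.extremePoints ℝ | IsAdjacent P x w} = Set.range fun i => ⟨y i, hext i⟩ := by
      ext w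
      simp only [Set.mem_ofPred_eq, hadj, Set.mem_range, Subtype.ext_iff, eq_comm]
    rw [this, ← Set.image_univ, Set.ncard_image_of_injective _ hinj, Set.ncard_univ, hcard x hx]
  · rintro i ⟨x, hx⟩ hxi
    obtain ⟨y, hadj, hext, hy, -⟩ := H.exists_local hb hs hx
    have hinj : Function.Injective fun i => (⟨y i, hext i⟩ : P.extremePoints ℝ) := by
      intro i j hij
      by_contra hne
      have h1 := (hy i j).2 (Ne.symm hne)
      rw [show y i = y j from congrArg Subtype.val hij] at h1
      exact (hy j j).1 h1 rfl
    have : {w : P.extremePoints ℝ | IsAdjacent P x w ∧ w ∈ {x : P.extremePoints ℝ |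
        inner ℝ (a i) (x : E3) = b i}} =
        (fun i => ⟨y i, hext i⟩) '' (Set.univ \ {⟨i, hxi⟩}) := by
      ext w
      simp only [Set.mem_ofPred_eq, hadj, Set.mem_image, Subtype.ext_iff, Set.mem_sdiff,
        Set.mem_univ, true_and, Set.mem_singleton_iff]
      constructor
      · rintro ⟨⟨j, hj⟩, hw⟩
        refine ⟨j, fun e => ?_, hj.symm⟩
        rw [hj] at hw
        exact (hy j ⟨i, hxi⟩).1 hw (Subtype.ext e.symm)
      · rintro ⟨j, hj, hw⟩
        refine ⟨⟨j, hw.symm⟩, ?_⟩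
        rw [← hw]
        exact (hy j ⟨i, hxi⟩).2 fun e => hj (congrArg Subtype.val e).symm
    rw [this, Set.ncard_image_of_injective _ hinj,
      Set.ncard_sdiff_singleton_of_mem (Set.mem_univ _), Set.ncard_univ, hcard x hx]
  · rintro ⟨x, hx⟩ ⟨w, hw⟩ hxw
    obtain ⟨y, hadj, hext, hy, -⟩ := H.exists_local hb hs hx
    obtain ⟨i, rfl⟩ := (hadj w).1 hxw
    exact ⟨i, i.2, fun h => (hy i i).1 h rfl⟩
  · rintro i j ⟨p, hp⟩ ⟨q, hq⟩ ⟨r, hr⟩ hpi hpj hqi hqj hri hrj hpq hpr hqr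
    by_contra hij
    obtain ⟨y, hadj, hext, hy, hcone⟩ := H.exists_local hb hs hp
    have hij' : (⟨i, hpi⟩ : IsIrredundant.Tight a b p) ≠ ⟨j, hpj⟩ := fun e =>
      hij (congrArg Subtype.val e)
    -- Of the three tight inequalities at p only one, k, is neither i nor j. So the points common to
    -- both facets lie on the ray from p through `y k`, which contains just one other vertex.
    obtain ⟨k, hk⟩ : ∃ k : IsIrredundant.Tight a b p,
        ∀ l, l ≠ k → l = ⟨i, hpi⟩ ∨ l = ⟨j, hpj⟩ := by
      by_contra! h
      obtain ⟨l, -, hl, hl'⟩ := h ⟨i, hpi⟩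
      obtain ⟨m, hm, hm', hm''⟩ := h l
      have h4 : ({⟨i, hpi⟩, ⟨j, hpj⟩, l, m} : Finset (IsIrredundant.Tight a b p)).card = 4 := by
        rw [Finset.card_insert_of_notMem, Finset.card_insert_of_notMem,
          Finset.card_insert_of_notMem, Finset.card_singleton]
        · simpa using hm.symm
        · simpa using ⟨hl'.symm, hm''.symm⟩
        · simpa using ⟨hij, hl.symm, hm'.symm⟩
      have h5 := Finset.card_le_univ
        ({⟨i, hpi⟩, ⟨j, hpj⟩, l, m} : Finset (IsIrredundant.Tight a b p))
      rw [← Nat.card_eq_fintype_card, hcard p hp] at h5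
      omega
    have key : ∀ z ∈ P.extremePoints ℝ, inner ℝ (a i) z = b i → inner ℝ (a j) z = b j →
        z ≠ p → z = y k := by
      intro z hz hzi hzj hzp
      obtain ⟨c, hc0, hc, h⟩ := hcone z hz.1
      rw [Finset.sum_eq_single k (fun l _ hl => ?_)
        (fun h => absurd (Finset.mem_univ _) h)] at h
      · exact eq_of_extremePoints_ray hp.1 (hext k) hz (hc0 k) h hzp
      · rw [(hc l).2, zero_smul]
        rcases hk l hl with rfl | rfl <;> assumption
    have h1 := key q hq hqi hqj fun e => hpq (Subtype.ext e.symm)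
    have h2 := key r hr hri hrj fun e => hpr (Subtype.ext e.symm)
    exact hqr (Subtype.ext (h1.trans h2.symm))
  · rw [hle]
    exact H.le_of_adj hb hs x.2 p.2.1 (S := ∅) (by simp) (by simp) φ
      fun y hy h _ => ((hφ x ⟨y, hy⟩).1 (hx ⟨y, hy⟩ h)).le
  · rw [hle]
    have := H.le_of_adj hb hs x.2 p.2.1 (S := ∅) (by simp) (by simp) (-φ)
      fun y hy h _ => neg_le_neg ((hφ ⟨y, hy⟩ x).1 (hx ⟨y, hy⟩ h)).le
    exact neg_le_neg_iff.1 this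
  · rw [hle]
    refine H.le_of_adj hb hs x.2 p.2.1 (S := {i}) (by simpa using hxi) (by simpa using hp) φ
      fun y hy h h' => ((hφ x ⟨y, hy⟩).1 (hx ⟨y, hy⟩ (h' i rfl) h)).le
  · rw [hle]
    have := H.le_of_adj hb hs x.2 p.2.1 (S := {i}) (by simpa using hxi) (by simpa using hp) (-φ)
      fun y hy h h' => neg_le_neg ((hφ ⟨y, hy⟩ x).1 (hx ⟨y, hy⟩ (h' i rfl) h)).le
    exact neg_le_neg_iff.1 this

/-- A point that is determined by its tight inequalities is determined by their index set. -/
theorem IsIrredundant.finite_extremePoints (H : IsIrredundant P a b) :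
    (P.extremePoints ℝ).Finite := by
  refine Set.Finite.of_finite_image (f := fun x => {i | inner ℝ (a i) x = b i})
    (Set.toFinite _) fun x hx y hy hxy => ?_
  rw [← sub_eq_zero, ← neg_eq_zero, neg_sub]
  refine H.eq_zero_of_tight hx fun i hi => ?_
  have hi' : inner ℝ (a i) y = b i := (Set.ext_iff.1 hxy i).1 hi
  rw [inner_sub_right, hi, hi', sub_self]

/-- Every facet is compact and nonempty, hence has an extreme point. This is a vertex of P, and all
facets through a vertex are tight faces. -/
theorem IsIrredundant.numFacets_eq (H : IsIrredundant P a b) (hb : Bornology.IsBounded P)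
    (hs : ∀ v ∈ P.extremePoints ℝ, {F : Set E3 | IsFacet P F ∧ v ∈ F}.ncard = 3) :
    numFacets P = Nat.card ι := by
  have hrange : {F : Set E3 | IsFacet P F} = Set.range (IsIrredundant.tight P a b) := by
    ext F
    constructor
    · intro hF
      have hne : F.Nonempty := by
        rw [Set.nonempty_iff_ne_empty]
        rintro rfl
        have := hF.2
        rw [vectorSpan_empty, finrank_bot] at this
        omega
      have hPc : IsCompact P := Metric.isCompact_of_isClosed_isBounded H.isClosed hb
      obtain ⟨v, hv⟩ := (hF.1.isCompact hPc).extremePoints_nonempty hne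
      have hvP := hF.1.isExtreme.extremePoints_subset_extremePoints hv
      have h := (H.card_tight hvP (hs v hvP)).2
      obtain ⟨i, hi⟩ := (Set.ext_iff.1 h F).1 ⟨hF, hv.1⟩
      exact ⟨i, hi⟩
    · rintro ⟨i, rfl⟩
      exact H.isFacet_tight i
  rw [numFacets, hrange, ← Set.image_univ, Set.ncard_image_of_injective _ H.tight_injective,
    Set.ncard_univ]

end Polytope

/-! ### First-step analysis of the random walk -/

theorem expectedSteps_eq (P : Set E3) (φ : E3 →L[ℝ] ℝ) (v : E3) :
    expectedSteps P φ v = (PMF.pure v).toOuterMeasure {x | ¬ IsMinOn φ P x} +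
      ∑' w, step P φ v w * expectedSteps P φ w := by
  unfold expectedSteps
  rw [tsum_eq_zero_add' ENNReal.summable]
  congr 1
  simp only [walk, PMF.toOuterMeasure_bind_apply]
  rw [ENNReal.tsum_comm]
  simp only [ENNReal.tsum_mul_left]

theorem expectedSteps_of_isMinOn {P : Set E3} {φ : E3 →L[ℝ] ℝ} {v : E3} (hv : IsMinOn φ P v) :
    expectedSteps P φ v = 0 := by
  have hne : ¬ (improvingNeighbors P φ v).Nonempty := by
    rintro ⟨w, hw, hlt⟩
    exact (isMinOn_iff.1 hv w (hw.2.subset (right_mem_segment _ _ _))).not_gt hlt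
  have hstep : step P φ v = PMF.pure v := dif_neg fun h => hne h.2
  have hwalk : ∀ k, walk P φ k v = PMF.pure v := by
    intro k
    induction k with
    | zero => rfl
    | succ k ih => rw [walk, hstep, PMF.pure_bind, ih]
  unfold expectedSteps
  simp [hwalk, hv]

theorem expectedSteps_of_improvingNeighbors {P : Set E3} {φ : E3 →L[ℝ] ℝ} {v : E3} {s : Finset E3}
    (hs : improvingNeighbors P φ v = s) (hne : s.Nonempty) :
    expectedSteps P φ v = 1 + (s.card : ℝ≥0∞)⁻¹ * ∑ w ∈ s, expectedSteps P φ w := by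
  classical
  have hv : ¬ IsMinOn φ P v := by
    intro hv
    obtain ⟨w, hw⟩ := hne
    obtain ⟨hw, hlt⟩ : w ∈ improvingNeighbors P φ v := hs ▸ hw
    exact (isMinOn_iff.1 hv w (hw.2.subset (right_mem_segment _ _ _))).not_gt hlt
  have hstep : step P φ v = PMF.uniformOfFinset s hne := by
    have h : (improvingNeighbors P φ v).Finite ∧ (improvingNeighbors P φ v).Nonempty :=
      ⟨hs ▸ s.finite_toSet, hs ▸ hne⟩
    rw [step, dif_pos h]
    congr 1
    ext w
    simp [hs]
  rw [expectedSteps_eq, hstep]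
  congr 1
  · simp [hv]
  · rw [tsum_eq_sum (s := s) fun w hw => by
      rw [PMF.uniformOfFinset_apply_of_notMem hne hw, zero_mul], Finset.mul_sum]
    exact Finset.sum_congr rfl fun w hw => by rw [PMF.uniformOfFinset_apply_of_mem hne hw]

theorem toReal_expectedSteps {P : Set E3} {φ : E3 →L[ℝ] ℝ} {v : E3} {s : Finset E3}
    (hs : improvingNeighbors P φ v = s) (hne : s.Nonempty)
    (hfin : ∀ w ∈ s, expectedSteps P φ w ≠ ⊤) :
    (expectedSteps P φ v).toReal = 1 + (s.card : ℝ)⁻¹ * ∑ w ∈ s, (expectedSteps P φ w).toReal := by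
  rw [expectedSteps_of_improvingNeighbors hs hne, ENNReal.toReal_add ENNReal.one_ne_top,
    ENNReal.toReal_mul, ENNReal.toReal_sum hfin]
  · simp
  · refine ENNReal.mul_ne_top ?_ (ENNReal.sum_ne_top.2 hfin)
    simpa using hne.ne_empty

theorem expectedSteps_le {P : Set E3} {φ : E3 →L[ℝ] ℝ} (hP : IsSimpleThreePolytope P)
    (hφ : IsGeneric P φ) {v : E3} (hv : v ∈ P.extremePoints ℝ) :
    expectedSteps P φ v ≤ ENNReal.ofReal (130 / 87 * ((numFacets P : ℝ) - 3) + 66) := by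
  classical
  obtain ⟨⟨hb, m, a', b', hab⟩, hint, hs⟩ := hP
  obtain ⟨J, H⟩ := exists_isIrredundant hint hab
  have hfinV : Finite (P.extremePoints ℝ) := H.finite_extremePoints
  let f : P.extremePoints ℝ → ℝ := fun v => φ v
  have hf : Function.Injective f := fun x y h => Subtype.ext (hφ x.2 y.2 h)
  let _ : LinearOrder (P.extremePoints ℝ) := LinearOrder.lift' f hf
  have hlt : ∀ x y : P.extremePoints ℝ, x < y ↔ φ x < φ y := fun x y => Iff.rfl
  have C := H.isSimpleComplex hb hs φ hlt
  set Adj : P.extremePoints ℝ → P.extremePoints ℝ → Prop := fun x y => IsAdjacent P x y with hAdj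
  have hext : ∀ x ∈ P.extremePoints ℝ, ∀ w, IsAdjacent P x w → w ∈ P.extremePoints ℝ := by
    intro x hx w hw
    have := Fintype.ofFinite (IsIrredundant.Tight (fun i : J => a' i) (fun i : J => b' i) x)
    obtain ⟨y, hadj, hy, -⟩ := H.exists_local hb hs hx
    obtain ⟨i, rfl⟩ := (hadj w).1 hw
    exact hy i
  have hfin : ∀ x ∈ P.extremePoints ℝ, (improvingNeighbors P φ x).Finite := fun x hx =>
    (Set.toFinite (P.extremePoints ℝ)).subset fun w hw => hext x hx w hw.1
  have himp : ∀ (x : P.extremePoints ℝ) (w : E3), w ∈ improvingNeighbors P φ x ↔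
      ∃ h : w ∈ P.extremePoints ℝ, Down Adj x ⟨w, h⟩ := fun x w =>
    ⟨fun h => ⟨hext x x.2 w h.1, h⟩, fun ⟨_, h⟩ => h⟩
  have hmin : ∀ x : P.extremePoints ℝ, (∀ y, x ≤ y) → IsMinOn φ P x := fun x hx =>
    isMinOn_iff.2 fun p hp => H.le_of_adj hb hs x.2 hp (S := ∅) (by simp) (by simp) φ
      fun y hy _ _ => hx ⟨y, hy⟩
  -- Finiteness has to come first: the averaging identities are used in ℝ, and `toReal` would send ⊤
  -- to 0.
  have htop : ∀ x : P.extremePoints ℝ, expectedSteps P φ x ≠ ⊤ := by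
    intro x
    induction x using WellFoundedLT.induction with
    | ind x ih =>
      by_cases hne : (improvingNeighbors P φ x).Nonempty
      · have hfx := hfin x x.2
        have hne' : hfx.toFinset.Nonempty := by simpa using hne
        rw [expectedSteps_of_improvingNeighbors (s := hfx.toFinset) (by simp) hne']
        refine ENNReal.add_ne_top.2 ⟨ENNReal.one_ne_top, ENNReal.mul_ne_top ?_
          (ENNReal.sum_ne_top.2 fun w hw => ?_)⟩
        · simpa using hne'.ne_empty
        · obtain ⟨h, hd⟩ := (himp x w).1 (by simpa using hw)
          exact ih ⟨w, h⟩ hd.2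
      · rw [expectedSteps_of_isMinOn]
        · exact ENNReal.zero_ne_top
        · refine hmin x (C.min fun y hy => lt_of_le_of_ne (not_lt.1 fun h => ?_) fun e => ?_)
          · exact hne ⟨y, hy, h⟩
          · exact C.irrefl (e ▸ hy)
  have hbound := C.expected_le (E := fun x => (expectedSteps P φ x).toReal)
    (fun x hx => by rw [expectedSteps_of_isMinOn (hmin x hx), ENNReal.toReal_zero])
    (fun x y hxy => by
      have hs' : improvingNeighbors P φ x = (({(y : E3)} : Finset E3) : Set E3) := by
        ext w
        rw [himp, Finset.coe_singleton, Set.mem_singleton_iff]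
        constructor
        · rintro ⟨h, hd⟩
          exact congrArg Subtype.val ((hxy _).1 hd)
        · rintro rfl
          exact ⟨y.2, hxy.out⟩
      rw [toReal_expectedSteps hs' (by simp) (by simpa using htop y)]
      simp)
    (fun x y z hxy => by
      have hs' : improvingNeighbors P φ x = (({(y : E3), (z : E3)} : Finset E3) : Set E3) := by
        ext w
        rw [himp, Finset.coe_insert, Finset.coe_singleton, Set.mem_insert_iff,
          Set.mem_singleton_iff]
        constructor
        · rintro ⟨h, hd⟩
          exact ((hxy.2 _).1 hd).imp (congrArg Subtype.val) (congrArg Subtype.val)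
        · rintro (rfl | rfl)
          exacts [⟨y.2, hxy.left⟩, ⟨z.2, hxy.right⟩]
      have hne : (y : E3) ≠ z := fun e => hxy.1 (Subtype.ext e)
      rw [toReal_expectedSteps hs' (by simp) (by simpa using ⟨htop y, htop z⟩),
        Finset.sum_pair hne, Finset.card_pair hne]
      push_cast
      ring)
    (fun x y hxy => by
      have hfx := hfin x x.2
      have hne : hfx.toFinset.Nonempty := ⟨y, by simpa using (himp x y).2 ⟨y.2, hxy⟩⟩
      -- An average is at most its largest term. This holds for any number of improving neighbors,
      -- in particular for three at the maximum.
      obtain ⟨z, hz, hmax⟩ := Finset.exists_max_image hfx.toFinset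
        (fun w => (expectedSteps P φ w).toReal) hne
      obtain ⟨hz', hd⟩ := (himp x z).1 (by simpa using hz)
      refine ⟨⟨z, hz'⟩, hd, ?_⟩
      rw [toReal_expectedSteps (s := hfx.toFinset) (by simp) hne fun w hw => ?_]
      · have hc : (0 : ℝ) < hfx.toFinset.card := by exact_mod_cast hne.card_pos
        have := Finset.sum_le_card_nsmul _ _ _ hmax
        rw [nsmul_eq_mul] at this
        have h2 := mul_le_mul_of_nonneg_left this (inv_nonneg.2 hc.le)
        rw [inv_mul_cancel_left₀ hc.ne'] at h2
        linarith
      · obtain ⟨h, -⟩ := (himp x w).1 (by simpa using hw)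
        exact htop ⟨w, h⟩) ⟨v, hv⟩
  rw [H.numFacets_eq hb hs]
  rw [← ENNReal.ofReal_toReal (htop ⟨v, hv⟩)]
  exact ENNReal.ofReal_le_ofReal hbound

/-! ### The linearity coefficient -/

theorem linearityCoefficient_le : linearityCoefficient ≤ ENNReal.ofReal (130 / 87) := by
  have h1 : ∀ n : ℕ, worstCase n ≤ ENNReal.ofReal (130 / 87 * ((n : ℝ) - 3) + 66) := by
    intro n
    refine iSup_le fun P => iSup_le fun φ => iSup_le fun v => iSup_le fun hP => iSup_le fun hn =>
      iSup_le fun hφ => iSup_le fun hv => ?_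
    exact hn ▸ expectedSteps_le hP hφ hv
  have h2 : ∀ᶠ n : ℕ in Filter.atTop,
      worstCase n / (n : ℝ≥0∞) ≤ ENNReal.ofReal (130 / 87 + 66 / (n : ℝ)) := by
    filter_upwards [Filter.eventually_gt_atTop 0] with n hn
    have hn' : (0 : ℝ) < n := by exact_mod_cast hn
    rw [← ENNReal.ofReal_natCast n]
    refine (ENNReal.div_le_div_right (h1 n) _).trans ?_
    rw [← ENNReal.ofReal_div_of_pos hn']
    refine ENNReal.ofReal_le_ofReal ?_
    rw [div_le_iff₀ hn', add_mul, div_mul_cancel₀ _ hn'.ne']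
    linarith
  have h3 : Filter.Tendsto (fun n : ℕ => ENNReal.ofReal (130 / 87 + 66 / (n : ℝ))) Filter.atTop
      (nhds (ENNReal.ofReal (130 / 87))) := by
    refine ENNReal.tendsto_ofReal ?_
    simpa using (tendsto_const_div_atTop_nhds_zero_nat (66 : ℝ)).const_add (130 / 87)
  exact (Filter.limsup_le_limsup h2).trans h3.limsup_eq.le

end RandomEdge

theorem mainTheorem1 :
    (∃ C : ℝ, ∀ (n : ℕ) (P : Set RandomEdge.E3) (φ : RandomEdge.E3 →L[ℝ] ℝ),
      RandomEdge.IsSimpleThreePolytope P → RandomEdge.numFacets P = n →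
      RandomEdge.IsGeneric P φ → ∀ v ∈ P.extremePoints ℝ,
        RandomEdge.expectedSteps P φ v ≤ ENNReal.ofReal (130 / 87 * ((n : ℝ) - 3) + C)) ∧
    RandomEdge.linearityCoefficient ≤ ENNReal.ofReal (130 / 87) ∧
    (130 / 87 : ℝ) < 1.4943 := by
  refine ⟨⟨66, fun n P φ hP hn hφ v hv => hn ▸ RandomEdge.expectedSteps_le hP hφ hv⟩,
    RandomEdge.linearityCoefficient_le, by norm_num⟩
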